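/- Let $p$ be a prime number and let $N=(t_q)_q$ be a family of natural numbers $t_q\in\mathbb N=\{0,1,2,\dots\}$ indexed by the primes $q$, with $t_p\neq 0$. Put $[n]:=\prod_q q^{t_q v_q(n)}$ for $n\ge 1$. Let $\mathcal L_{pV}$ be the two-sorted language with $+,-,0,1$, binary relations $\equiv_n$ ($n\in\mathbb N$) and constants $c_{n,j}$ ($n\ge 1$, $0\le j<[n]$) on the first sort $G$, with $<,S,0_\Gamma,\infty$ on the second sort $\Gamma\cup\{\infty\}$, and with a function symbol $V:G\to\Gamma\cup\{\infty\}$. Let $T_{pV,N}$ be the $\mathcal L_{pV}$-theory with the following axioms. 1. $(G,+,-,0)$ is an abelian group; $x\equiv_n y$ iff $x=y+ng$ for some $g\in G$; $[G:qG]=q^{t_q}$ for every prime $q$; $c_{n,j}\not\equiv_n c_{n,k}$ for $j\ne k$, and $c_{n,0}=0$. 2. $(\Gamma,<)$ is a discrete linear order with first element $0_\Gamma$ and no last element, in which every element other than $0_\Gamma$ has a predecessor; $\gamma<\infty$ for all $\gamma\in\Gamma$; $S$ is the successor function, with $S(\infty)=\infty$. 3. $V$ is surjective; $V(x)=\infty$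 iff $x=0$; $V(nx)=V(x)+v_p(n)$ for every nonzero integer $n$; $V(x+y)\ge\min\{V(x),V(y)\}$. Here $\gamma+k$ denotes $S^k(\gamma)$. 4. $V(1)=0_\Gamma$; and for every $n\ge 1$ such that $t_q\neq 0$ for all primes $q\mid n$, the elements $0,1,\dots,n-1$ (multiples of $1\in G$) lie in distinct classes modulo $nG$, and $c_{n,k}=k$ for $k\le n-1$. 5. If $V(x)=V(y)\neq\infty$, then there is a unique integer $i$ with $0<i<p$ and $V(x-iy)>V(x)$. 6. For every $n\ge 1$, $nG$ is dense in $\{x\in G: V(x)\ge v_p(n)\}$ (where $v_p(n)$ stands for $S^{v_p(n)}(0_\Gamma)$): for all $x\in G$ and $\gamma\in\Gamma$ with $V(x)\ge v_p(n)$ and $\gamma\ge v_p(n)$ there is $y\in nG$ with $V(x-y)\ge\gamma$. **Theorem.** For every such $N$, the theory $T_{pV,N}$ is NIP: for every formula $\varphi(x;y)$, with $x,y$ finite tuples of variables of either sort, no model $M$ of $T_{pV,N}$ contains tuples $(a_i)_{i\in\mathbb N}$ and $(b_I)_{I\subseteq\mathbb N}$ such that, for all $i\in\mathbb N$ and $I\subseteq\mathbb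 N$, $M\models\varphi(a_i;b_I)$ if and only if $i\in I$. Moreover, the complete theory of the two-sorted structure $\big((\mathbb Z,+,-,0,1,\equiv_n (n\in\mathbb N)),(\mathbb N\cup\{\infty\},<,S,0,\infty),v_p\big)$ is NIP. -/

import Mathlib

/-!
# Two-sorted first-order logic for `p`-valued groups, the theories `T_{pV,N}`, and NIP

The language has a group sort with `+, -, 0, 1, ≡_n` (`n : ℕ`) and constant symbols indexed by a
type `C`; a value sort with `<, S, 0_Γ, ∞`; and a function symbol `V` from the group sort to the
value sort. Each sort has the variables `0, 1, 2, …`, and equality is available in both sorts.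
-/

universe u

namespace PV

/-- Terms of the group sort. -/
inductive GTerm (C : Type) : Type
  | var (i : ℕ) : GTerm C
  | const (c : C) : GTerm C
  | zero : GTerm C
  | one : GTerm C
  | add (s t : GTerm C) : GTerm C
  | neg (t : GTerm C) : GTerm C

/-- Terms of the value sort. -/
inductive VTerm (C : Type) : Type
  | var (i : ℕ) : VTerm C
  | zero : VTerm C
  | infty : VTerm C
  | succ (t : VTerm C) : VTerm C
  | val (t : GTerm C) : VTerm C

/-- First-order formulas. `allG i φ` and `allV i φ` quantify over the variable number `i` of the
group sort and of the value sort, respectively. -/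
inductive Formula (C : Type) : Type
  | falsum : Formula C
  | eqG (s t : GTerm C) : Formula C
  | eqV (s t : VTerm C) : Formula C
  | cong (n : ℕ) (s t : GTerm C) : Formula C
  | lt (s t : VTerm C) : Formula C
  | imp (φ ψ : Formula C) : Formula C
  | allG (i : ℕ) (φ : Formula C) : Formula C
  | allV (i : ℕ) (φ : Formula C) : Formula C

/-- Structures for the language: arbitrary interpretations of all symbols. -/
structure Str (C : Type) : Type (u + 1) where
  /-- the group sort -/
  G : Type u
  /-- the value sort (it contains the interpretation of `∞`) -/
  Γ : Type u
  zero : G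
  one : G
  add : G → G → G
  neg : G → G
  cong : ℕ → G → G → Prop
  const : C → G
  lt : Γ → Γ → Prop
  succ : Γ → Γ
  zeroΓ : Γ
  infty : Γ
  val : G → Γ

section Semantics

variable {C : Type}

/-- The value of a term of the group sort under the assignment `g`. -/
def GTerm.eval (M : Str.{u} C) (g : ℕ → M.G) : GTerm C → M.G
  | .var i => g i
  | .const c => M.const c
  | .zero => M.zero
  | .one => M.one
  | .add s t => M.add (s.eval M g) (t.eval M g)
  | .neg t => M.neg (t.eval M g)

/-- The value of a term of the value sort under the assignment `(g, γ)`. -/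
def VTerm.eval (M : Str.{u} C) (g : ℕ → M.G) (γ : ℕ → M.Γ) : VTerm C → M.Γ
  | .var i => γ i
  | .zero => M.zeroΓ
  | .infty => M.infty
  | .succ t => M.succ (t.eval M g γ)
  | .val t => M.val (t.eval M g)

/-- Tarski's truth definition: `φ` holds in `M` under the assignment `(g, γ)`. -/
def Formula.Realize (M : Str.{u} C) : Formula C → (ℕ → M.G) → (ℕ → M.Γ) → Prop
  | .falsum, _, _ => False
  | .eqG s t, g, _ => s.eval M g = t.eval M g
  | .eqV s t, g, γ => s.eval M g γ = t.eval M g γ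
  | .cong n s t, g, _ => M.cong n (s.eval M g) (t.eval M g)
  | .lt s t, g, γ => M.lt (s.eval M g γ) (t.eval M g γ)
  | .imp φ ψ, g, γ => φ.Realize M g γ → ψ.Realize M g γ
  | .allG i φ, g, γ => ∀ x : M.G, φ.Realize M (Function.update g i x) γ
  | .allV i φ, g, γ => ∀ x : M.Γ, φ.Realize M g (Function.update γ i x)

/-- `φ` is true in `M`: it holds under all assignments (free variables, if there are any, are read
as universally quantified). -/
def Str.Satisfies (M : Str.{u} C) (φ : Formula C) : Prop :=
  ∀ (g : ℕ → M.G) (γ : ℕ → M.Γ), φ.Realize M g γ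

/-- `M` is a model of the theory `T`. -/
def Str.IsModel (M : Str.{u} C) (T : Set (Formula C)) : Prop :=
  ∀ φ ∈ T, M.Satisfies φ

/-- The complete theory of the structure `M`. -/
def Str.theory (M : Str.{u} C) : Set (Formula C) :=
  {φ | M.Satisfies φ}

/-- `φ(x; y)` shatters an infinite set in `M`. The tuple `x` consists of the group variables in `X`
and the value variables in `Y`, and `y` of all other variables. There are tuples `a i` (`i : ℕ`)
for `x` and tuples `b I` (`I ⊆ ℕ`) for `y` such that `φ(a i; b I)` holds iff `i ∈ I`;
the tuples `a i` are then automatically distinct. -/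
def Formula.ShattersInfinite (M : Str.{u} C) (φ : Formula C) (X Y : Finset ℕ) : Prop :=
  ∃ (a : ℕ → ℕ → M.G) (a' : ℕ → ℕ → M.Γ) (b : Set ℕ → ℕ → M.G) (b' : Set ℕ → ℕ → M.Γ),
    ∀ (i : ℕ) (I : Set ℕ),
      φ.Realize M (X.piecewise (a i) (b I)) (Y.piecewise (a' i) (b' I)) ↔ i ∈ I

/-- The theory `T` is NIP: no partitioned formula shatters an infinite set in a model of `T`. -/
def IsNIP (T : Set (Formula C)) : Prop :=
  ∀ M : Str.{u} C, M.IsModel T →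
    ∀ (φ : Formula C) (X Y : Finset ℕ), ¬ φ.ShattersInfinite M X Y

end Semantics

section Abbreviations

variable {C : Type}

namespace Formula

def not (φ : Formula C) : Formula C := imp φ falsum
def and (φ ψ : Formula C) : Formula C := not (imp φ (not ψ))
def or (φ ψ : Formula C) : Formula C := imp (not φ) ψ
def iff (φ ψ : Formula C) : Formula C := and (imp φ ψ) (imp ψ φ)
def exG (i : ℕ) (φ : Formula C) : Formula C := not (allG i (not φ))
def exV (i : ℕ) (φ : Formula C) : Formula C := not (allV i (not φ))
def le (s t : VTerm C) : Formula C := or (lt s t) (eqV s t)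

/-- Conjunction of a finite list. -/
def conj : List (Formula C) → Formula C
  | [] => not falsum
  | φ :: l => and φ (conj l)

/-- Disjunction of a finite list. -/
def disj : List (Formula C) → Formula C
  | [] => falsum
  | φ :: l => or φ (disj l)

/-- `∃ x₀ … ∃ x_{k-1}, φ` in the group sort. -/
def exGs : ℕ → Formula C → Formula C
  | 0, φ => φ
  | k + 1, φ => exGs k (exG k φ)

end Formula

/-- `t + ⋯ + t` (`n` times). -/
def GTerm.nsmul : ℕ → GTerm C → GTerm C
  | 0, _ => .zero
  | n + 1, t => .add (GTerm.nsmul n t) t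

/-- `n t` for an integer `n`. -/
def GTerm.zsmul : ℤ → GTerm C → GTerm C
  | .ofNat n, t => .nsmul n t
  | .negSucc n, t => .neg (.nsmul (n + 1) t)

/-- `s - t`. -/
def GTerm.sub (s t : GTerm C) : GTerm C := .add s (.neg t)

/-- `S^k(t)`, which is written `t + k`. -/
def VTerm.succs : ℕ → VTerm C → VTerm C
  | 0, t => t
  | k + 1, t => .succ (VTerm.succs k t)

end Abbreviations

infix:50 " =ᴳ " => PV.Formula.eqG
infix:50 " =ⱽ " => PV.Formula.eqV
infix:50 " <ⱽ " => PV.Formula.lt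
infix:50 " ≤ⱽ " => PV.Formula.le
prefix:max "¬ᶠ" => PV.Formula.not
infixr:36 " ∧ᶠ " => PV.Formula.and
infixr:32 " ∨ᶠ " => PV.Formula.or
infixr:26 " →ᶠ " => PV.Formula.imp
infixr:22 " ↔ᶠ " => PV.Formula.iff

/-- Given the exponents `t_q = N q` with `[G : qG] = q ^ t_q` for all primes `q`, this is the index
`[G : nG] = ∏ q ^ (t_q * v_q(n))` of `nG` in the torsion-free group `G`, for `n ≥ 1`. -/
def idx (N : Nat.Primes → ℕ) (n : ℕ) : ℕ :=
  ∏ q ∈ n.primeFactors.subtype Nat.Prime, (q : ℕ) ^ (N q * padicValNat q n)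

/-- The constant symbols `c_{n,j}` with `n ≥ 1` and `0 ≤ j < [G : nG]`. -/
structure CosetConst (N : Nat.Primes → ℕ) : Type where
  n : ℕ+
  j : Fin (idx N n)

section Theory

open Formula

/-- The variables of the group sort. -/
abbrev gv {C : Type} (i : ℕ) : GTerm C := .var i
/-- The variables of the value sort. -/
abbrev vv {C : Type} (i : ℕ) : VTerm C := .var i

/-- The `k` terms `xᵢ` (`i < k`) are pairwise incongruent modulo `n`. -/
def pairwiseIncongruent {C : Type} (n k : ℕ) : Formula C :=
  conj ((List.range k).flatMap fun i => (List.range i).map fun j => ¬ᶠ(cong n (gv i) (gv j)))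

/-- The sentence `[G : nG] = k`. -/
def indexEq {C : Type} (n k : ℕ) : Formula C :=
  exGs k (pairwiseIncongruent n k ∧ᶠ
    allG k (disj ((List.range k).map fun i => cong n (gv k) (gv i))))

/-- The formula `V(x₀ - i x₁) > V(x₀)`. -/
def digit {C : Type} (i : ℕ) : Formula C :=
  .val (gv 0) <ⱽ .val (.sub (gv 0) (.nsmul i (gv 1)))

/-- The axioms of `T_{pV,N}`, where `N` assigns to each prime `q` the (finite) exponent `t_q`.
As all the indices `[G : nG]` are finite, there are no axioms of equidistribution. -/
inductive Axioms (p : ℕ) (N : Nat.Primes → ℕ) : Formula (CosetConst N) → Prop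
  -- abelian groups
  | add_assoc : Axioms p N <| allG 0 <| allG 1 <| allG 2 <|
      .add (.add (gv 0) (gv 1)) (gv 2) =ᴳ .add (gv 0) (.add (gv 1) (gv 2))
  | add_comm : Axioms p N <| allG 0 <| allG 1 <| .add (gv 0) (gv 1) =ᴳ .add (gv 1) (gv 0)
  | add_zero : Axioms p N <| allG 0 <| .add (gv 0) .zero =ᴳ gv 0
  | add_neg : Axioms p N <| allG 0 <| .add (gv 0) (.neg (gv 0)) =ᴳ .zero
  -- congruences, indices and representatives of the cosets
  | cong_iff (n : ℕ) : Axioms p N <| allG 0 <| allG 1 <|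
      cong n (gv 0) (gv 1) ↔ᶠ exG 2 (gv 0 =ᴳ .add (gv 1) (.nsmul n (gv 2)))
  | index (q : Nat.Primes) : Axioms p N <| indexEq q (q ^ N q)
  | const_incongruent (n : ℕ+) (j k : Fin (idx N n)) (h : j ≠ k) : Axioms p N <|
      ¬ᶠ(cong n (.const ⟨n, j⟩) (.const ⟨n, k⟩))
  | const_zero (n : ℕ+) (j : Fin (idx N n)) (h : (j : ℕ) = 0) : Axioms p N <|
      .const ⟨n, j⟩ =ᴳ .zero
  -- `Γ` is a discrete linear order with first element `0` and without last element, `S` is the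
  -- successor function, and `∞` lies above `Γ`
  | lt_irrefl : Axioms p N <| allV 0 <| ¬ᶠ(vv 0 <ⱽ vv 0)
  | lt_trans : Axioms p N <| allV 0 <| allV 1 <| allV 2 <|
      vv 0 <ⱽ vv 1 →ᶠ vv 1 <ⱽ vv 2 →ᶠ vv 0 <ⱽ vv 2
  | lt_total : Axioms p N <| allV 0 <| allV 1 <|
      vv 0 <ⱽ vv 1 ∨ᶠ vv 0 =ⱽ vv 1 ∨ᶠ vv 1 <ⱽ vv 0
  | zero_le : Axioms p N <| allV 0 <| .zero ≤ⱽ vv 0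
  | zero_lt_infty : Axioms p N <| .zero <ⱽ .infty
  | le_infty : Axioms p N <| allV 0 <| vv 0 ≤ⱽ .infty
  | no_last : Axioms p N <| allV 0 <|
      vv 0 <ⱽ .infty →ᶠ exV 1 (vv 0 <ⱽ vv 1 ∧ᶠ vv 1 <ⱽ .infty)
  | succ : Axioms p N <| allV 0 <| vv 0 <ⱽ .infty →ᶠ
      vv 0 <ⱽ .succ (vv 0) ∧ᶠ .succ (vv 0) <ⱽ .infty ∧ᶠ
        allV 1 (vv 0 <ⱽ vv 1 →ᶠ .succ (vv 0) ≤ⱽ vv 1)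
  | succ_infty : Axioms p N <| .succ .infty =ⱽ .infty
  | pred : Axioms p N <| allV 0 <|
      .zero <ⱽ vv 0 →ᶠ vv 0 <ⱽ .infty →ᶠ exV 1 (.succ (vv 1) =ⱽ vv 0)
  -- `V` is surjective and makes `G` a `p`-valued group
  | val_surjective : Axioms p N <| allV 0 <| exG 0 <| .val (gv 0) =ⱽ vv 0
  | val_eq_infty : Axioms p N <| allG 0 <| .val (gv 0) =ⱽ .infty ↔ᶠ gv 0 =ᴳ .zero
  | val_zsmul (n : ℤ) (h : n ≠ 0) : Axioms p N <| allG 0 <|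
      .val (.zsmul n (gv 0)) =ⱽ .succs (padicValInt p n) (.val (gv 0))
  | val_add : Axioms p N <| allG 0 <| allG 1 <|
      .val (gv 0) ≤ⱽ .val (.add (gv 0) (gv 1)) ∨ᶠ .val (gv 1) ≤ⱽ .val (.add (gv 0) (gv 1))
  -- the element `1`
  | val_one : Axioms p N <| .val .one =ⱽ .zero
  | one_incongruent (n : ℕ+) (hn : ∀ q : Nat.Primes, (q : ℕ) ∣ n → N q ≠ 0)
      (i j : ℕ) (hij : i < j) (hj : j < n) : Axioms p N <|
      ¬ᶠ(cong n (.nsmul i .one) (.nsmul j .one))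
  | const_one (n : ℕ+) (hn : ∀ q : Nat.Primes, (q : ℕ) ∣ n → N q ≠ 0)
      (k : Fin (idx N n)) (hk : (k : ℕ) < n) : Axioms p N <|
      .const ⟨n, k⟩ =ᴳ .nsmul k .one
  -- if `V(x) = V(y) ≠ ∞`, then there is a unique `0 < i < p` with `V(x - i y) > V(x)`
  | digits : Axioms p N <| allG 0 <| allG 1 <|
      .val (gv 0) =ⱽ .val (gv 1) →ᶠ .val (gv 0) <ⱽ .infty →ᶠ
        disj ((List.range' 1 (p - 1)).map fun i =>
          digit i ∧ᶠ conj (((List.range' 1 (p - 1)).filter (· ≠ i)).map fun j => ¬ᶠ(digit j)))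
  -- regular density: `nG` is dense in `{x | V(x) ≥ v_p(n)}`
  | dense (n : ℕ+) : Axioms p N <| allG 0 <|
      .succs (padicValNat p n) .zero ≤ⱽ .val (gv 0) →ᶠ
        allV 0 (.succs (padicValNat p n) .zero ≤ⱽ vv 0 →ᶠ vv 0 <ⱽ .infty →ᶠ
          exG 1 (exG 2 (gv 1 =ᴳ .nsmul n (gv 2)) ∧ᶠ vv 0 ≤ⱽ .val (.sub (gv 0) (gv 1))))

/-- The theory `T_{pV,N}`. -/
def TpV (p : ℕ) (N : Nat.Primes → ℕ) : Set (Formula (CosetConst N)) :=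
  {φ | Axioms p N φ}

end Theory

/-- The two-sorted structure with sorts `ℤ` and `ℕ ∪ {∞}` and with the `p`-adic valuation, in the
language without the constants `c_{n,j}`. -/
noncomputable def intStr (p : ℕ) : Str.{0} Empty where
  G := ℤ
  Γ := ℕ∞
  zero := 0
  one := 1
  add x y := x + y
  neg x := -x
  cong n x y := x ≡ y [ZMOD n]
  const := Empty.elim
  lt γ δ := γ < δ
  succ γ := γ + 1
  zeroΓ := 0
  infty := ⊤
  val x := emultiplicity (p : ℤ) x

end PV

/-! The proof combines a quantifier elimination inside a single model with a count of traces.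

Elimination (`determined`): the truth of a formula depends only on the inequalities between
boundedly many shifts `S^a` of finitely many points (values of integer combinations of the group
entries, value entries, `0_Γ`) and on the classes of finitely many group entries modulo one `n`.
This is a back-and-forth argument. To match a new group element `x`, choose a multiple `N x` and a
combination `c` of the old entries so close to it that each relevant value is `V(N x - k) = min(V(N
x - c), V(c - k))`; the digit axiom makes this possible (`exists_best_approx`). Then `V(N x - c)` is
the only new value. The discrete order supplies its counterpart (`exists_sameOrder_extend`), and
regular density realizes that counterpart in a prescribed congruence class
(`exists_val_eq_of_congruent`).

Counting: given `α_i` (`i < m`) and `β`, let `k` maximize `V(α_k + β)`. Then `V(α_i + β) = min(V(α_k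
+ β), V(α_i - α_k))` for all `i` (`val_add_eq_min`). Hence a parameter tuple acts on `a_0, …,
a_{m-1}` only through some indices `k < m`, the positions of some elements of `Γ` relative to each
other and to families of `m` elements, and residues modulo `n`. As `G/nG` is finite, this leaves
polynomially many traces in `m`, whereas shattering needs `2^m`.

The argument uses only the sentences in `CoreAxioms`, which follow from `T_{pV,N}` and hold in `ℤ`;
this settles both claims at once. -/

namespace PV

/-! ### Discrete linear orders with endpoints -/

/-- `Γ` is a discrete linear order with first element `o`, together with an element `t` on top of
it; `S` is the successor function and fixes `t`. -/
structure IsDiscreteOrder {Γ : Type*} [LinearOrder Γ] (S : Γ → Γ) (o t : Γ) : Prop where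
  bot_le : ∀ γ, o ≤ γ
  le_top : ∀ γ, γ ≤ t
  bot_lt_top : o < t
  succ_top : S t = t
  lt_succ : ∀ γ, γ < t → γ < S γ
  succ_lt_top : ∀ γ, γ < t → S γ < t
  succ_le : ∀ γ δ, γ < δ → S γ ≤ δ
  pred : ∀ γ, o < γ → γ < t → ∃ δ, S δ = γ

/-- The families `w` and `w'` satisfy the same inequalities `S^a(wᵢ) ≤ S^b(wⱼ)` with `i, j ∈ Λ` and
`a, b ≤ e`. -/
def SameOrder {Γ L : Type*} [LE Γ] (S : Γ → Γ) (Λ : Set L) (e : ℕ) (w w' : L → Γ) : Prop :=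
  ∀ i ∈ Λ, ∀ j ∈ Λ, ∀ a ≤ e, ∀ b ≤ e, S^[a] (w i) ≤ S^[b] (w j) ↔ S^[a] (w' i) ≤ S^[b] (w' j)

/-- Extension of a family by one element. -/
def extend {Γ L : Type*} (w : L → Γ) (δ : Γ) : Option L → Γ := fun i => i.elim δ w

namespace IsDiscreteOrder

variable {Γ : Type*} [LinearOrder Γ] {S : Γ → Γ} {o t : Γ} (h : IsDiscreteOrder S o t)

include h

theorem strictMono : StrictMono S := by
  intro x y hxy
  rcases (h.le_top y).lt_or_eq with hy | rfl
  · exact (h.succ_le x y hxy).trans_lt (h.lt_succ y hy)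
  · rw [h.succ_top]; exact h.succ_lt_top x hxy

theorem iterate_le_iterate_iff (n : ℕ) {x y : Γ} : S^[n] x ≤ S^[n] y ↔ x ≤ y :=
  (h.strictMono.iterate n).le_iff_le

theorem le_succ (x : Γ) : x ≤ S x := by
  rcases (h.le_top x).lt_or_eq with hx | rfl
  · exact (h.lt_succ x hx).le
  · rw [h.succ_top]

theorem iterate_le_iterate {m n : ℕ} (hmn : m ≤ n) (x : Γ) : S^[m] x ≤ S^[n] x :=
  Function.monotone_iterate_of_id_le (f := S) (fun x => h.le_succ x) hmn x

theorem le_iterate (n : ℕ) (x : Γ) : x ≤ S^[n] x := h.iterate_le_iterate (Nat.zero_le n) x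

theorem iterate_top (n : ℕ) : S^[n] t = t := Function.iterate_fixed h.succ_top n

theorem iterate_lt_top (n : ℕ) {x : Γ} (hx : x < t) : S^[n] x < t := by
  simpa [h.iterate_top] using h.strictMono.iterate n hx

theorem iterate_lt_iterate {m n : ℕ} (hmn : m < n) {x : Γ} (hx : x < t) : S^[m] x < S^[n] x := by
  refine (h.lt_succ _ (h.iterate_lt_top m hx)).trans_le ?_
  rw [← Function.iterate_succ_apply' S]
  exact h.iterate_le_iterate hmn x

theorem iterate_le_iterate_self_iff {m n : ℕ} {x : Γ} : S^[m] x ≤ S^[n] x ↔ m ≤ n ∨ t ≤ x := by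
  rcases (h.le_top x).lt_or_eq with hx | rfl
  · refine ⟨fun hle => ?_, fun hmn => ?_⟩
    · by_contra! hlt
      exact absurd hle (h.iterate_lt_iterate hlt.1 hx).not_ge
    · exact h.iterate_le_iterate (hmn.resolve_right hx.not_ge) x
  · simp [h.iterate_top]

theorem iterate_min (n : ℕ) (x y : Γ) : S^[n] (min x y) = min (S^[n] x) (S^[n] y) :=
  (h.strictMono.iterate n).monotone.map_min

/-- By discreteness, each shift of `x` that is excluded as a value of `δ` pushes `δ` one step
further up. This yields the gaps in the back-and-forth for orders. -/
theorem iterate_succ_le {x δ : Γ} (hx : x ≤ δ) (e : ℕ) (hne : ∀ d ≤ e, δ ≠ S^[d] x) :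
    S^[e + 1] x ≤ δ := by
  induction e with
  | zero => exact h.succ_le _ _ (hx.lt_of_ne fun heq => hne 0 le_rfl heq.symm)
  | succ e ih =>
    rw [Function.iterate_succ_apply']
    exact h.succ_le _ _ ((ih fun d hd => hne d (by omega)).lt_of_ne fun heq =>
      hne (e + 1) le_rfl heq.symm)

theorem exists_iterate_eq (n : ℕ) {γ : Γ} (hγ : S^[n] o ≤ γ) : ∃ δ, S^[n] δ = γ := by
  induction n generalizing γ with
  | zero => exact ⟨γ, rfl⟩
  | succ n ih =>
    rcases (h.le_top γ).lt_or_eq with hlt | rfl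
    · have ho : o < γ := (h.iterate_lt_iterate n.succ_pos h.bot_lt_top).trans_le hγ
      obtain ⟨γ', rfl⟩ := h.pred γ ho hlt
      rw [Function.iterate_succ_apply', h.strictMono.le_iff_le] at hγ
      obtain ⟨δ, rfl⟩ := ih hγ
      exact ⟨δ, Function.iterate_succ_apply' S n δ⟩
    · exact ⟨γ, h.iterate_top _⟩

/-- A family which is obtained from `W` by minima and inverse shifts satisfies the same
inequalities as the family which is obtained from `W'` in the same way. -/
theorem sameOrder_of_min {L L' : Type*} {Λ : Set L} {Λ' : Set L'} {e E : ℕ} {w w' : L → Γ}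
    {W W' : L' → Γ} (hW : SameOrder S Λ' (e + E) W W')
    (hw : ∀ i ∈ Λ, ∃ q ≤ E, ∃ α ∈ Λ', ∃ β ∈ Λ', S^[q] (w i) = min (W α) (W β) ∧
      S^[q] (w' i) = min (W' α) (W' β)) : SameOrder S Λ e w w' := by
  intro i hi j hj a ha b hb
  obtain ⟨q, hq, α, hα, β, hβ, h₁, h₂⟩ := hw i hi
  obtain ⟨r, hr, α', hα', β', hβ', h₃, h₄⟩ := hw j hj
  -- Shifting both sides by `q + r` undoes the inverse shifts, so that only minima of the known
  -- families are compared; this costs at most `E` extra shifts.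
  have key : ∀ x y : Γ, S^[a] x ≤ S^[b] y ↔ S^[a + r] (S^[q] x) ≤ S^[b + q] (S^[r] y) := by
    intro x y
    rw [← h.iterate_le_iterate_iff (q + r)]
    simp only [← Function.iterate_add_apply]
    rw [show q + r + a = a + r + q by ring, show q + r + b = b + q + r by ring]
  rw [key, key, h₁, h₂, h₃, h₄]
  simp only [h.iterate_min, min_le_iff, le_min_iff]
  rw [hW α hα α' hα' _ (by omega) _ (by omega), hW α hα β' hβ' _ (by omega) _ (by omega),
    hW β hβ α' hα' _ (by omega) _ (by omega), hW β hβ β' hβ' _ (by omega) _ (by omega)]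

/-- Back and forth for families in a discrete linear order. -/
theorem exists_sameOrder_extend {L : Type*} {Λ : Finset L} {e : ℕ} {w w' : L → Γ}
    (hw : SameOrder S Λ (2 * e + 2) w w') {z z' : L} (hz : z ∈ Λ) (hz' : z' ∈ Λ)
    (h₀ : w z = o) (h₀' : w' z = o) (h₁ : w z' = t) (h₁' : w' z' = t) (δ : Γ) :
    ∃ δ', SameOrder S {i : Option L | ∀ j ∈ i, j ∈ Λ} e (extend w δ) (extend w' δ') := by
  suffices H : ∃ δ', ∀ i ∈ Λ, ∀ a ≤ e, ∀ b ≤ e,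
      (S^[a] (w i) ≤ S^[b] δ ↔ S^[a] (w' i) ≤ S^[b] δ') ∧
      (S^[a] δ ≤ S^[b] (w i) ↔ S^[a] δ' ≤ S^[b] (w' i)) by
    obtain ⟨δ', H⟩ := H
    refine ⟨δ', ?_⟩
    rintro (_ | i) hi (_ | j) hj a ha b hb
    -- Comparing shifts of `δ` with each other only tests whether `δ` is the top element, which is
    -- read off from the comparison with `w z' = t`.
    · have := (H z' hz' 0 (by omega) 0 (by omega)).1
      simp only [Function.iterate_zero, id_eq, h₁, h₁'] at this
      simp only [extend, Option.elim]
      rw [h.iterate_le_iterate_self_iff, h.iterate_le_iterate_self_iff, this]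
    · exact (H j (hj j rfl) a ha b hb).2
    · exact (H i (hi i rfl) a ha b hb).1
    · exact hw i (hi i rfl) j (hj j rfl) a (by omega) b (by omega)
  -- Three cases: `δ` is at most `e` steps above some `w i`, at most `e` steps below some `w i`, or
  -- far from all of them. In the first two cases `δ'` is forced.
  by_cases hA : ∃ i ∈ Λ, ∃ d ≤ e, δ = S^[d] (w i)
  · obtain ⟨i, hi, d, hd, rfl⟩ := hA
    refine ⟨S^[d] (w' i), fun j hj a ha b hb => ?_⟩
    simp only [← Function.iterate_add_apply]
    exact ⟨hw j hj i hi _ (by omega) _ (by omega), hw i hi j hj _ (by omega) _ (by omega)⟩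
  by_cases hB : ∃ i ∈ Λ, ∃ d ≤ e, S^[d] δ = w i
  · obtain ⟨i, hi, d, hd, hδ⟩ := hB
    have : S^[d] o ≤ w' i := by
      have := hw z hz i hi d (by omega) 0 (by omega)
      rw [h₀, h₀'] at this
      refine this.1 ?_
      simp only [Function.iterate_zero, id_eq, ← hδ, h.iterate_le_iterate_iff, h.bot_le]
    obtain ⟨δ', hδ'⟩ := h.exists_iterate_eq d this
    refine ⟨δ', fun j hj a ha b hb => ?_⟩
    rw [← h.iterate_le_iterate_iff d, ← h.iterate_le_iterate_iff d (x := S^[a] (w' j)),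
      ← h.iterate_le_iterate_iff d (x := S^[a] δ), ← h.iterate_le_iterate_iff d (x := S^[a] δ')]
    rw [← (Function.Commute.refl S).iterate_iterate b d |>.eq δ, hδ,
      ← (Function.Commute.refl S).iterate_iterate a d |>.eq δ, hδ,
      ← (Function.Commute.refl S).iterate_iterate b d |>.eq δ', hδ',
      ← (Function.Commute.refl S).iterate_iterate a d |>.eq δ', hδ']
    simp only [← Function.iterate_add_apply]
    exact ⟨hw j hj i hi _ (by omega) _ (by omega), hw i hi j hj _ (by omega) _ (by omega)⟩
  push Not at hA hB
  have hlow : ∀ i ∈ Λ, w i ≤ δ → S^[e + 1] (w i) ≤ δ := fun i hi hle =>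
    h.iterate_succ_le hle e fun d hd => hA i hi d hd
  have hupp : ∀ i ∈ Λ, δ ≤ w i → S^[e + 1] δ ≤ w i := fun i hi hle =>
    h.iterate_succ_le hle e fun d hd => (hB i hi d hd).symm
  obtain ⟨k, hk, hmax⟩ := Finset.exists_max_image (Λ.filter fun i => w i ≤ δ) w
    ⟨z, by simp [hz, h₀, h.bot_le]⟩
  rw [Finset.mem_filter] at hk
  simp only [Finset.mem_filter, and_imp] at hmax
  have hδt : δ < t := (h.le_top δ).lt_of_ne (by simpa [h₁] using hA z' hz' 0 (by omega))
  have hkt : w' k < t := by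
    rw [← not_le, ← h₁']
    have := hw z' hz' k hk.1 0 (by omega) 0 (by omega)
    simp only [Function.iterate_zero, id_eq] at this
    rw [← this, h₁, not_le]
    exact hk.2.trans_lt hδt
  -- Here `w k` is the largest entry below `δ`. Entries above `δ` are at least `2e + 2` steps above
  -- `w k`, and the same holds for `w'`; so there is room for a point more than `e` steps from both
  -- sides.
  refine ⟨S^[e + 1] (w' k), fun i hi a ha b hb => ?_⟩
  have hδt' := h.iterate_lt_top (e + 1) hkt
  rcases le_total (w i) δ with hle | hle
  · have h3 : w' i ≤ w' k := by
      have := hw i hi k hk.1 0 (by omega) 0 (by omega)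
      exact this.1 (hmax i hi hle)
    have h4 : ∀ d ≤ e, S^[d] (w i) < δ := fun d hd =>
      (h.iterate_lt_iterate (by omega) (hle.trans_lt hδt)).trans_le (hlow i hi hle)
    have h5 : ∀ d ≤ e, S^[d] (w' i) < S^[e + 1] (w' k) := fun d hd =>
      ((h.strictMono.iterate d).monotone h3).trans_lt (h.iterate_lt_iterate (by omega) hkt)
    exact ⟨iff_of_true ((h4 a ha).le.trans (h.le_iterate b _))
        ((h5 a ha).le.trans (h.le_iterate b _)),
      iff_of_false ((h4 b hb).trans_le (h.le_iterate a _)).not_ge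
        ((h5 b hb).trans_le (h.le_iterate a _)).not_ge⟩
  · have h3 : S^[2 * e + 2] (w' k) ≤ w' i := by
      refine (hw k hk.1 i hi _ le_rfl 0 (by omega)).1 (le_trans ?_ (hupp i hi hle))
      rw [show 2 * e + 2 = (e + 1) + (e + 1) by ring, Function.iterate_add_apply,
        h.iterate_le_iterate_iff]
      exact hlow k hk.1 hk.2
    have h4 : ∀ d ≤ e, S^[d] δ < w i := fun d hd =>
      (h.iterate_lt_iterate (by omega) hδt).trans_le (hupp i hi hle)
    have h5 : ∀ d ≤ e, S^[d] (S^[e + 1] (w' k)) < w' i := fun d hd => by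
      refine lt_of_lt_of_le ?_ h3
      rw [← Function.iterate_add_apply]
      exact h.iterate_lt_iterate (by omega) hkt
    exact ⟨iff_of_false ((h4 b hb).trans_le (h.le_iterate a _)).not_ge
        ((h5 b hb).trans_le (h.le_iterate a _)).not_ge,
      iff_of_true ((h4 a ha).le.trans (h.le_iterate b _))
        ((h5 a ha).le.trans (h.le_iterate b _))⟩

end IsDiscreteOrder

/-! ### `p`-valued groups -/

/-- `(G, V)` is a regularly dense `p`-valued group with finite indices `[G : qG]`, and with values
in a discrete linear order. -/
structure IsPValuedGroup (p : ℕ) {G Γ : Type*} [AddCommGroup G] [LinearOrder Γ] (S : Γ → Γ)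
    (o t : Γ) (V : G → Γ) : Prop extends IsDiscreteOrder S o t where
  val_surjective : Function.Surjective V
  val_eq_top_iff : ∀ x, V x = t ↔ x = 0
  val_zsmul : ∀ (n : ℤ) (x), n ≠ 0 → V (n • x) = S^[padicValInt p n] (V x)
  le_val_add : ∀ x y, min (V x) (V y) ≤ V (x + y)
  digit : ∀ x y, V x = V y → V x < t → ∃ i < p, V x < V (x - i • y)
  dense : ∀ n : ℕ, 0 < n → ∀ x, S^[padicValNat p n] o ≤ V x → ∀ γ < t,
    S^[padicValNat p n] o ≤ γ → ∃ z, γ ≤ V (x - n • z)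
  finite_index : ∀ q : ℕ, q.Prime → ∃ s : Finset G, ∀ x, ∃ c ∈ s, ∃ z, x = c + q • z

namespace IsPValuedGroup

variable {p : ℕ} {G Γ : Type*} [AddCommGroup G] [LinearOrder Γ] {S : Γ → Γ} {o t : Γ} {V : G → Γ}
  (h : IsPValuedGroup p S o t V)

include h

theorem val_zero : V 0 = t := (h.val_eq_top_iff 0).2 rfl

theorem val_neg (x : G) : V (-x) = V x := by
  simpa [padicValInt] using h.val_zsmul (-1) x (by norm_num)

theorem val_sub_comm (x y : G) : V (x - y) = V (y - x) := by
  rw [← h.val_neg, neg_sub]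

theorem val_add_of_lt {x y : G} (hxy : V x < V y) : V (x + y) = V x := by
  refine le_antisymm ?_ ((min_eq_left hxy.le).symm.le.trans (h.le_val_add x y))
  by_contra! hlt
  have := h.le_val_add (x + y) (-y)
  rw [h.val_neg, add_neg_cancel_right] at this
  exact absurd this (lt_min hlt hxy).not_ge

/-- The second alternative is the case `x = 0`, where the formula needs no condition on `V y`. -/
theorem val_add_of_ne {x y : G} (hxy : V x ≠ V y ∨ V x = t) : V (x + y) = min (V x) (V y) := by
  rcases hxy with hxy | hx
  · rcases lt_or_gt_of_ne hxy with hlt | hlt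
    · rw [h.val_add_of_lt hlt, min_eq_left hlt.le]
    · rw [add_comm, h.val_add_of_lt hlt, min_eq_right hlt.le]
  · rw [hx, (h.val_eq_top_iff x).1 hx, zero_add, min_eq_right (h.le_top _)]

/-- Finite index is given for primes only; representatives `c` modulo `a` and `c'` modulo `b`
combine to `c + a c'` modulo `a b`. -/
theorem exists_reps (n : ℕ) (hn : 0 < n) : ∃ s : Finset G, ∀ x, ∃ c ∈ s, ∃ z, x = c + n • z := by
  classical
  induction n using Nat.recOnMul with
  | zero => omega
  | one => exact ⟨{0}, fun x => ⟨0, by simp, x, by simp⟩⟩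
  | prime q hq => exact h.finite_index q hq
  | mul a b iha ihb =>
    obtain ⟨s, hs⟩ := iha (Nat.pos_of_mul_pos_right hn)
    obtain ⟨s', hs'⟩ := ihb (Nat.pos_of_mul_pos_left hn)
    refine ⟨Finset.image₂ (fun c c' => c + a • c') s s', fun x => ?_⟩
    obtain ⟨c, hc, y, rfl⟩ := hs x
    obtain ⟨c', hc', z, rfl⟩ := hs' y
    exact ⟨_, Finset.mem_image₂_of_mem hc hc', z, by rw [smul_add, mul_smul]; abel⟩

/-- There are elements of a given value in a given class modulo `M`, provided that the value
satisfies the same inequalities with small numbers as the value of some element of the class. -/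
theorem exists_val_eq_of_congruent {M : ℕ} (hM : 0 < M) (r : G) {δ : Γ}
    (ht : δ = t → V r = t)
    (hδ : ∀ d ≤ padicValNat p M, (S^[d] o ≤ V r ↔ S^[d] o ≤ δ) ∧ (V r ≤ S^[d] o ↔ δ ≤ S^[d] o)) :
    ∃ z, V (r + M • z) = δ := by
  by_cases heq : V r = δ
  · exact ⟨0, by simpa⟩
  set v := padicValNat p M with hv
  have hlt : δ < t := (h.le_top δ).lt_of_ne fun hδt => heq ((ht hδt).trans hδt.symm)
  -- Otherwise `V r` is a numeral `S^d o` with `d ≤ v`, and the hypothesis forces `δ` to be the same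
  -- numeral.
  have hle : S^[v] o ≤ V r := by
    by_contra hcon
    have hne : ∃ d ≤ v, V r = S^[d] o := by
      by_contra! hne
      exact hcon ((h.iterate_le_iterate (Nat.le_succ v) o).trans
        (h.iterate_succ_le (h.bot_le _) v hne))
    obtain ⟨d, hd, hr⟩ := hne
    have := hδ d hd
    exact heq (hr.trans (le_antisymm (this.1.1 hr.symm.le) (this.2.1 hr.le)))
  have hle' : S^[v] o ≤ δ := (hδ v le_rfl).1.1 hle
  obtain ⟨y, rfl⟩ := h.val_surjective δ
  have hsub : S^[v] o ≤ V (y - r) := by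
    rw [sub_eq_add_neg]
    exact (le_min hle' (by rwa [h.val_neg])).trans (h.le_val_add y (-r))
  -- Density is applied to `y - r` with precision one step beyond `δ = V y`, so that `r + M z`
  -- differs from `y` by an element of value greater than `δ`.
  obtain ⟨z, hz⟩ := h.dense M hM _ hsub (S (V y)) (h.succ_lt_top _ hlt)
    (hle'.trans (h.le_succ _))
  refine ⟨z, ?_⟩
  have : V (y + (r + M • z - y)) = V y := by
    apply h.val_add_of_lt
    rw [h.val_sub_comm, ← sub_sub]
    exact (h.lt_succ _ hlt).trans_le hz
  simpa using this

/-- Among the integer combinations of given elements there is one which approximates `y` best, in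
the sense that the value of the difference is no value of a difference with the given elements. -/
theorem exists_best_approx {ι : Type*} (T : Finset ι) (hT : T.Nonempty) (f : ι → G) (y : G) :
    ∃ i ∈ T, ∃ j ∈ T, ∃ m ≤ p, ∀ k ∈ T, V (y - (f i + m • (f j - f i))) ≠
      V (f i + m • (f j - f i) - f k) ∨ V (y - (f i + m • (f j - f i))) = t := by
  obtain ⟨i, hi, hmax⟩ := T.exists_max_image (fun i => V (y - f i)) hT
  -- If `f i` itself is not good enough, one correcting digit brings the approximation strictly
  -- closer than every `f k`. An equality of values for some `k` would then make `f k` closer to `y`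
  -- than the optimal `f i`.
  by_cases hcase : ∃ j ∈ T, V (y - f i) = V (f j - f i) ∧ V (y - f i) < t
  · obtain ⟨j, hj, hij, hlt⟩ := hcase
    obtain ⟨m, hm, hdig⟩ := h.digit _ _ hij hlt
    refine ⟨i, hi, j, hj, m, hm.le, fun k hk => Or.inl fun heq => ?_⟩
    rw [← sub_sub] at heq
    have h₁ := h.le_val_add (y - f i - m • (f j - f i)) (f i + m • (f j - f i) - f k)
    rw [← heq, min_self, show y - f i - m • (f j - f i) + (f i + m • (f j - f i) - f k) = y - f k by
      abel] at h₁
    exact absurd (hdig.trans_le h₁) (hmax k hk).not_gt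
  · push Not at hcase
    refine ⟨i, hi, i, hi, 0, Nat.zero_le p, fun k hk => ?_⟩
    by_contra! hcon
    simp only [zero_smul, add_zero] at hcon
    refine absurd ((h.le_top _).lt_of_ne hcon.2) (hcase k hk ?_).not_gt
    rw [hcon.1, h.val_sub_comm]

end IsPValuedGroup

/-! ### Back and forth in `p`-valued groups -/

section BackAndForth

variable {p : ℕ} {G Γ J : Type*} [AddCommGroup G]

theorem linearCombination_update [DecidableEq J] (g : J → G) (j : J) (x : G) (f : J →₀ ℤ) :
    Finsupp.linearCombination ℤ (Function.update g j x) f =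
      f j • x + Finsupp.linearCombination ℤ g (f.erase j) := by
  conv_lhs => rw [← Finsupp.single_add_erase j f]
  rw [map_add, Finsupp.linearCombination_single, Function.update_self]
  congr 1
  rw [Finsupp.linearCombination_apply, Finsupp.linearCombination_apply]
  refine Finsupp.sum_congr fun i hi => ?_
  rw [Function.update_of_ne]
  rintro rfl
  simp at hi

theorem exists_linearCombination_eq_add {g g' : J → G} {n : ℕ} (f : J →₀ ℤ)
    (hg : ∀ j ∈ f.support, ∃ z, g' j = g j + n • z) :
    ∃ z, Finsupp.linearCombination ℤ g' f = Finsupp.linearCombination ℤ g f + n • z := by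
  choose! z hz using hg
  refine ⟨Finsupp.linearCombination ℤ z f, ?_⟩
  simp only [Finsupp.linearCombination_apply, Finsupp.sum, Finset.smul_sum,
    ← Finset.sum_add_distrib]
  refine Finset.sum_congr rfl fun j hj => ?_
  rw [hz j hj, smul_add, smul_comm]

/-- Names for the elements of the value sort which are obtained from a tuple: the values of the
integer combinations of the group elements, the entries of the value sort, and `0`. -/
abbrev Point (J : Type*) := (J →₀ ℤ) ⊕ Option ℕ

/-- The element of the value sort with a given name. -/
noncomputable def pt (V : G → Γ) (o : Γ) (g : J → G) (γ : ℕ → Γ) : Point J → Γ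
  | .inl f => V (Finsupp.linearCombination ℤ g f)
  | .inr none => o
  | .inr (some i) => γ i

variable [LinearOrder Γ] {S : Γ → Γ} {o t : Γ} {V : G → Γ}

/-- Two tuples agree on a finite set of atomic formulas. -/
structure Sim (S : Γ → Γ) (V : G → Γ) (o : Γ) (Λ : Finset (Point J)) (e : ℕ) (s : Finset J) (n : ℕ)
    (g : J → G) (γ : ℕ → Γ) (g' : J → G) (γ' : ℕ → Γ) : Prop where
  order : SameOrder S Λ e (pt V o g γ) (pt V o g' γ')
  cong : ∀ j ∈ s, ∃ z, g' j = g j + n • z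

omit [AddCommGroup G] in
theorem SameOrder.mono {L : Type*} {Λ Λ' : Set L} {e e' : ℕ} {w w' : L → Γ}
    (hw : SameOrder S Λ' e' w w') (hΛ : Λ ⊆ Λ') (he : e ≤ e') : SameOrder S Λ e w w' :=
  fun i hi j hj a ha b hb => hw i (hΛ hi) j (hΛ hj) a (ha.trans he) b (hb.trans he)

theorem Sim.mono {Λ Λ' : Finset (Point J)} {e e' : ℕ} {s s' : Finset J} {n n' : ℕ}
    {g g' : J → G} {γ γ' : ℕ → Γ} (hs : Sim S V o Λ' e' s' n' g γ g' γ') (h₁ : Λ ⊆ Λ')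
    (h₂ : e ≤ e') (h₃ : s ⊆ s') (h₄ : n ∣ n') : Sim S V o Λ e s n g γ g' γ' := by
  refine ⟨hs.order.mono (by exact_mod_cast h₁) h₂, fun j hj => ?_⟩
  obtain ⟨z, hz⟩ := hs.cong j (h₃ hj)
  obtain ⟨k, rfl⟩ := h₄
  exact ⟨k • z, by rw [hz, mul_smul]⟩

theorem Sim.symm {Λ : Finset (Point J)} {e : ℕ} {s : Finset J} {n : ℕ}
    {g g' : J → G} {γ γ' : ℕ → Γ} (hs : Sim S V o Λ e s n g γ g' γ') :
    Sim S V o Λ e s n g' γ' g γ := by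
  refine ⟨fun i hi j hj a ha b hb => (hs.order i hi j hj a ha b hb).symm, fun j hj => ?_⟩
  obtain ⟨z, hz⟩ := hs.cong j hj
  exact ⟨-z, by rw [hz, smul_neg, add_neg_cancel_right]⟩

variable (h : IsPValuedGroup p S o t V)

include h

theorem pt_zero (g : J → G) (γ : ℕ → Γ) : pt V o g γ (.inl 0) = t := by
  simp [pt, h.val_zero]

/-- A new value entry affects no combination of group elements, so the back-and-forth for orders
suffices once `0_Γ` and `∞` are among the points. -/
theorem exists_sim_update_value (Λ : Finset (Point J)) (e : ℕ) (s : Finset J) (n : ℕ) (j : ℕ) :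
    ∃ (Λ' : Finset (Point J)) (e' : ℕ), ∀ g γ g' γ', Sim S V o Λ' e' s n g γ g' γ' →
      ∀ x, ∃ x', Sim S V o Λ e s n g (Function.update γ j x) g' (Function.update γ' j x') := by
  classical
  refine ⟨insert (.inr none) (insert (.inl 0) Λ), 2 * e + 2, fun g γ g' γ' hs x => ?_⟩
  obtain ⟨x', hx'⟩ := h.exists_sameOrder_extend hs.order (z := .inr none) (z' := .inl 0)
    (by simp) (by simp) rfl rfl (pt_zero h g γ) (pt_zero h g' γ') x
  refine ⟨x', h.sameOrder_of_min (E := 0) hx' fun i hi => ?_, hs.cong⟩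
  by_cases hij : i = .inr (some j)
  · subst hij
    exact ⟨0, le_rfl, none, by simp, none, by simp, by simp [pt, extend], by simp [pt, extend]⟩
  · have hsome : (some i : Option (Point J)) ∈
        {i : Option (Point J) | ∀ j ∈ i, j ∈ insert (.inr none) (insert (.inl 0) Λ)} := by
      rintro _ ⟨⟩
      exact Finset.mem_insert_of_mem (Finset.mem_insert_of_mem (by exact_mod_cast hi))
    have hpt : ∀ (g : J → G) (γ : ℕ → Γ) (x : Γ),
        pt V o g (Function.update γ j x) i = pt V o g γ i := by
      intro g γ x
      rcases i with f | _ | i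
      · rfl
      · rfl
      · exact Function.update_of_ne (fun hne => hij (by rw [hne])) _ _
    exact ⟨0, le_rfl, some i, hsome, some i, hsome, by simp [hpt, extend], by simp [hpt, extend]⟩

/-- Every value involving `x` is, up to a shift, of the form `V(N x - k)` with `k` in a finite set
`T` of old combinations. A best approximation of `N x` reduces these to one new value, which is
transferred to the other tuple. -/
theorem exists_sim_update_group [DecidableEq J] (Λ : Finset (Point J)) (e : ℕ) (s : Finset J)
    (n : ℕ) (hn : 0 < n) (j : J) :
    ∃ (Λ' : Finset (Point J)) (e' : ℕ) (s' : Finset J) (n' : ℕ), 0 < n' ∧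
      ∀ g γ g' γ', Sim S V o Λ' e' s' n' g γ g' γ' →
        ∀ x, ∃ x', Sim S V o Λ e s n (Function.update g j x) γ (Function.update g' j x') γ' := by
  classical
  set F := Λ.toLeft with hF
  obtain ⟨N, hN, hnN, hdvd⟩ : ∃ N : ℕ, 0 < N ∧ n ∣ N ∧ ∀ f ∈ F, f j ≠ 0 → f j ∣ (N : ℤ) := by
    refine ⟨n * ∏ f ∈ F with f j ≠ 0, (f j).natAbs, Nat.mul_pos hn (Finset.prod_pos fun f hf => ?_),
      dvd_mul_right _ _, fun f hf hfj => Int.natAbs_dvd.1 (Int.natCast_dvd_natCast.2 ?_)⟩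
    · exact Int.natAbs_pos.2 (Finset.mem_filter.1 hf).2
    · exact (Finset.dvd_prod_of_mem (fun f : J →₀ ℤ => (f j).natAbs)
        (Finset.mem_filter.2 ⟨hf, hfj⟩)).mul_left _
  -- Multiplying the combination `f` by `N / f j` gives the coefficient `N` at `j`; the rest is `-τ
  -- f`.
  set τ : (J →₀ ℤ) → (J →₀ ℤ) := fun f => -((N / f j : ℤ) • f.erase j) with hτ
  set T : Finset (J →₀ ℤ) := insert 0 (F.image τ) with hT
  set T' : Finset (J →₀ ℤ) :=
    (T ×ˢ T ×ˢ Finset.range (p + 1)).image fun x => x.1 + x.2.2 • (x.2.1 - x.1) with hT'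
  set Λ' : Finset (Point J) := insert (.inr none) (insert (.inl 0) (Λ ∪
    (F.image fun f => .inl (f.erase j)) ∪ (T' ×ˢ T).image fun x => .inl (x.1 - x.2))) with hΛ'
  set E := ∑ f ∈ F, padicValInt p (N / f j) with hE
  -- The first bound pays for dividing by `N / f j`; the second locates the new value among the
  -- numerals up to `v_p(N²)`, as needed for realizing it modulo `N²`.
  set e₁ := max (e + E) (padicValNat p (N * N)) with he₁
  refine ⟨Λ', 2 * e₁ + 2, s ∪ T'.biUnion Finsupp.support, N * N, Nat.mul_pos hN hN,
    fun g γ g' γ' hs x => ?_⟩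
  have hbot : (.inr none : Point J) ∈ Λ' := by simp [hΛ']
  have htop : (.inl 0 : Point J) ∈ Λ' := by simp [hΛ']
  obtain ⟨a, ha, b, hb, m, hm, hbest⟩ := h.exists_best_approx T ⟨0, by simp [hT]⟩
    (Finsupp.linearCombination ℤ g) ((N : ℤ) • x)
  set c := a + m • (b - a) with hc
  have hcT : c ∈ T' := Finset.mem_image.2 ⟨(a, b, m), by simp [ha, hb]; omega, rfl⟩
  have hlc : Finsupp.linearCombination ℤ g a + m • (Finsupp.linearCombination ℤ g b -
      Finsupp.linearCombination ℤ g a) = Finsupp.linearCombination ℤ g c := by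
    simp [hc, map_add, map_nsmul, map_sub]
  simp only [hlc] at hbest
  simp only [← map_sub] at hbest
  set r := (N : ℤ) • x - Finsupp.linearCombination ℤ g c with hr
  obtain ⟨δ', hδ'⟩ := h.exists_sameOrder_extend hs.order hbot htop rfl rfl (pt_zero h g γ)
    (pt_zero h g' γ') (V r)
  have hmem : ∀ i ∈ Λ', some i ∈ {i : Option (Point J) | ∀ j ∈ i, j ∈ Λ'} := by
    rintro i hi _ ⟨⟩
    exact hi
  have hnone : none ∈ {i : Option (Point J) | ∀ j ∈ i, j ∈ Λ'} := by simp
  have hδt : V r = t ↔ δ' = t := by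
    have := hδ' _ (hmem _ htop) none hnone 0 (Nat.zero_le _) 0 (Nat.zero_le _)
    simp only [extend, Function.iterate_zero, id_eq, Option.elim, pt_zero h] at this
    simpa [(h.le_top _).ge_iff_eq] using this
  obtain ⟨z, hz⟩ := h.exists_val_eq_of_congruent (Nat.mul_pos hN hN) r (δ := δ') hδt.2
    fun d hd => ⟨hδ' _ (hmem _ hbot) none hnone d (hd.trans (le_max_right _ _)) 0 (Nat.zero_le _),
      hδ' none hnone _ (hmem _ hbot) 0 (Nat.zero_le _) d (hd.trans (le_max_right _ _))⟩
  obtain ⟨z', hz'⟩ := exists_linearCombination_eq_add c fun k hk =>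
    hs.cong k (Finset.mem_union_right _ (Finset.mem_biUnion.2 ⟨c, hcT, hk⟩))
  -- Modulus `N²` leaves a factor `N` after division by `N`: `r + N² z` plus the counterpart `c + N²
  -- z'` of `c` equals `N x'` with `x' ≡ x` modulo `N`, hence modulo `n`.
  refine ⟨x + N • (z + z'), ?_, fun k hk => ?_⟩
  · refine h.sameOrder_of_min (hδ'.mono subset_rfl (le_max_left _ _)) fun i hi => ?_
    rcases i with f | i
    · have hf : f ∈ F := by simpa [hF] using hi
      by_cases hfj : f j = 0
      · have hmem' := hmem (.inl (f.erase j)) (by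
          simp only [hΛ', Finset.mem_insert, Finset.mem_union, Finset.mem_image]
          exact Or.inr (Or.inr (Or.inl (Or.inr ⟨f, hf, rfl⟩))))
        refine ⟨0, Nat.zero_le _, _, hmem', _, hmem', ?_, ?_⟩ <;>
          simp [extend, pt, linearCombination_update, hfj]
      · have hτT : τ f ∈ T := Finset.mem_insert_of_mem (Finset.mem_image_of_mem _ hf)
        have hmem' := hmem (.inl (c - τ f)) (by
          simp only [hΛ', Finset.mem_insert, Finset.mem_union, Finset.mem_image]
          exact Or.inr (Or.inr (Or.inr ⟨(c, τ f), Finset.mem_product.2 ⟨hcT, hτT⟩, rfl⟩)))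
        have hquot : (N / f j : ℤ) * f j = N := Int.ediv_mul_cancel (hdvd f hf hfj)
        have hquot0 : (N / f j : ℤ) ≠ 0 := by
          intro h0
          rw [h0, zero_mul] at hquot
          exact hN.ne (by exact_mod_cast hquot)
        have hval : ∀ (g : J → G) (x : G),
            S^[padicValInt p (N / f j)] (pt V o (Function.update g j x) γ (.inl f)) =
              V ((N : ℤ) • x - Finsupp.linearCombination ℤ g (τ f)) := by
          intro g x
          rw [pt, ← h.val_zsmul _ _ hquot0, linearCombination_update, smul_add, ← mul_smul, hquot,
            hτ, map_neg, map_zsmul, sub_neg_eq_add]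
        have hne := hbest _ hτT
        refine ⟨_, Finset.single_le_sum (f := fun f : J →₀ ℤ => padicValInt p (N / f j))
          (fun _ _ => Nat.zero_le _) hf, none, hnone, _, hmem', ?_, ?_⟩
        · refine (hval g x).trans ?_
          simp only [extend, Option.elim, pt]
          rw [← h.val_add_of_ne hne, map_sub, hr]
          congr 1
          abel
        · refine (hval g' _).trans ?_
          simp only [extend, Option.elim, pt]
          -- The condition that makes the value of a sum a minimum is itself an order condition, so
          -- it passes to the second tuple.
          have hne' : δ' ≠ V (Finsupp.linearCombination ℤ g' (c - τ f)) ∨ δ' = t := by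
            refine hne.imp (fun hne heq => hne ?_) hδt.1
            refine le_antisymm ((hδ' none hnone _ hmem' 0 (Nat.zero_le _) 0 (Nat.zero_le _)).2 ?_)
              ((hδ' _ hmem' none hnone 0 (Nat.zero_le _) 0 (Nat.zero_le _)).2 ?_)
            · exact heq.le
            · exact heq.symm.le
          rw [← hz] at hne' ⊢
          rw [← h.val_add_of_ne hne', map_sub, hr, hz']
          congr 1
          simp only [smul_add, mul_smul, natCast_zsmul]
          abel
    · have hmem' := hmem (.inr i) (by
          simp only [hΛ', Finset.mem_insert, Finset.mem_union]
          exact Or.inr (Or.inr (Or.inl (Or.inl (by exact_mod_cast hi)))))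
      refine ⟨0, Nat.zero_le _, _, hmem', _, hmem', ?_, ?_⟩ <;>
        rcases i with _ | i <;> simp [extend, pt]
  · obtain ⟨d, hd⟩ := hnN
    by_cases hkj : k = j
    · subst hkj
      exact ⟨d • (z + z'), by simp only [Function.update_self, hd, mul_smul]⟩
    · obtain ⟨y, hy⟩ := hs.cong k (Finset.mem_union_left _ hk)
      refine ⟨(d * N) • y, ?_⟩
      rw [Function.update_of_ne hkj, Function.update_of_ne hkj, hy, ← mul_smul, ← mul_assoc, ← hd]

end BackAndForth

/-! ### Formulas are invariant under agreement on finitely many atomic formulas -/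

/-- The group sort, the value sort and the valuation of `M` form a `p`-valued group, and the symbols
of the language are interpreted accordingly. -/
structure Str.IsPValued (p : ℕ) {C : Type} (M : Str.{u} C) [AddCommGroup M.G]
    [LinearOrder M.Γ] : Prop where
  isPValuedGroup : IsPValuedGroup p M.succ M.zeroΓ M.infty M.val
  zero_eq : M.zero = 0
  add_eq : ∀ x y, M.add x y = x + y
  neg_eq : ∀ x, M.neg x = -x
  lt_iff : ∀ x y, M.lt x y ↔ x < y
  cong_iff : ∀ n x y, M.cong n x y ↔ ∃ z, x = y + n • z

/-- An assignment, together with the interpretations of the constants. -/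
def Str.tuple {C : Type} (M : Str.{u} C) (g : ℕ → M.G) : ℕ ⊕ Option C → M.G
  | .inl i => g i
  | .inr none => M.one
  | .inr (some c) => M.const c

theorem Str.tuple_update {C : Type} [DecidableEq (ℕ ⊕ Option C)] (M : Str.{u} C) (g : ℕ → M.G)
    (i : ℕ) (x : M.G) :
    M.tuple (Function.update g i x) = Function.update (M.tuple g) (.inl i) x := by
  funext j
  rcases j with j | _ | c
  · by_cases hij : j = i
    · subst hij; simp [Str.tuple]
    · rw [Function.update_of_ne (by simpa using hij)]
      exact Function.update_of_ne hij _ _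
  · rw [Function.update_of_ne (by simp)]; rfl
  · rw [Function.update_of_ne (by simp)]; rfl

namespace Str.IsPValued

variable {p : ℕ} {C : Type} {M : Str.{u} C} [AddCommGroup M.G] [LinearOrder M.Γ]
  (h : M.IsPValued p)

include h

theorem exists_eval_gterm (s : GTerm C) :
    ∃ f, ∀ g, s.eval M g = Finsupp.linearCombination ℤ (M.tuple g) f := by
  induction s with
  | var i => exact ⟨.single (.inl i) 1, fun g => by simp [GTerm.eval, Str.tuple]⟩
  | const c => exact ⟨.single (.inr (some c)) 1, fun g => by simp [GTerm.eval, Str.tuple]⟩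
  | zero => exact ⟨0, fun g => by simp [GTerm.eval, h.zero_eq]⟩
  | one => exact ⟨.single (.inr none) 1, fun g => by simp [GTerm.eval, Str.tuple]⟩
  | add s t ihs iht =>
    obtain ⟨f, hf⟩ := ihs
    obtain ⟨f', hf'⟩ := iht
    exact ⟨f + f', fun g => by simp [GTerm.eval, h.add_eq, hf, hf']⟩
  | neg t ih =>
    obtain ⟨f, hf⟩ := ih
    exact ⟨-f, fun g => by simp [GTerm.eval, h.neg_eq, hf]⟩

theorem exists_eval_vterm (s : VTerm C) :
    ∃ k α, ∀ g γ, s.eval M g γ = M.succ^[k] (pt M.val M.zeroΓ (M.tuple g) γ α) := by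
  induction s with
  | var i => exact ⟨0, .inr (some i), fun g γ => rfl⟩
  | zero => exact ⟨0, .inr none, fun g γ => rfl⟩
  | infty => exact ⟨0, .inl 0, fun g γ => by rw [pt_zero h.isPValuedGroup]; rfl⟩
  | succ s ih =>
    obtain ⟨k, α, hα⟩ := ih
    exact ⟨k + 1, α, fun g γ => by rw [VTerm.eval, hα, Function.iterate_succ_apply']⟩
  | val s =>
    obtain ⟨f, hf⟩ := h.exists_eval_gterm s
    exact ⟨0, .inl f, fun g γ => by simp [VTerm.eval, pt, hf]⟩

/-- `φ` is determined by finitely many atomic formulas. -/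
def Determined (M : Str.{u} C) [AddCommGroup M.G] [LinearOrder M.Γ] (φ : Formula C) : Prop :=
  ∃ (Λ : Finset (Point (ℕ ⊕ Option C))) (e : ℕ) (s : Finset (ℕ ⊕ Option C)) (n : ℕ), 0 < n ∧
    ∀ g γ g' γ', Sim M.succ M.val M.zeroΓ Λ e s n (M.tuple g) γ (M.tuple g') γ' →
      φ.Realize M g γ → φ.Realize M g' γ'

omit h in
theorem determined_of_points {φ : Formula C} (α β : Point (ℕ ⊕ Option C)) (k l : ℕ)
    (hφ : ∀ g γ g' γ', SameOrder M.succ {α, β} (max k l) (pt M.val M.zeroΓ (M.tuple g) γ)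
      (pt M.val M.zeroΓ (M.tuple g') γ') → φ.Realize M g γ → φ.Realize M g' γ') :
    Determined M φ := by
  classical
  exact ⟨{α, β}, max k l, ∅, 1, one_pos, fun g γ g' γ' hs =>
    hφ g γ g' γ' (by simpa using hs.order)⟩

/-- Equality of `s` and `t` means `V(s - t) = ∞`, and `∞` is the point named by the zero
combination. -/
theorem determined_eqG (s t : GTerm C) : Determined M (.eqG s t) := by
  obtain ⟨f, hf⟩ := h.exists_eval_gterm s
  obtain ⟨f', hf'⟩ := h.exists_eval_gterm t
  have key : ∀ g γ, Formula.Realize M (.eqG s t) g γ ↔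
      pt M.val M.zeroΓ (M.tuple g) γ (.inl 0) ≤ pt M.val M.zeroΓ (M.tuple g) γ (.inl (f - f')) := by
    intro g γ
    rw [pt_zero h.isPValuedGroup, (h.isPValuedGroup.le_top _).ge_iff_eq', pt, eq_comm (a := M.infty),
      h.isPValuedGroup.val_eq_top_iff, map_sub, sub_eq_zero, ← hf, ← hf']
    rfl
  refine determined_of_points (.inl 0) (.inl (f - f')) 0 0 fun g γ g' γ' hs => ?_
  rw [key, key]
  exact (hs _ (by simp) _ (by simp) 0 (Nat.zero_le _) 0 (Nat.zero_le _)).1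

theorem determined_cong (n : ℕ) (s t : GTerm C) : Determined M (.cong n s t) := by
  classical
  have key : ∀ g γ, Formula.Realize M (.cong n s t) g γ ↔
      ∃ z, s.eval M g = t.eval M g + n • z := fun g γ => h.cong_iff _ _ _
  -- Congruence modulo `0` is equality; it must be separated because the modulus in `Determined` is
  -- positive.
  rcases n.eq_zero_or_pos with rfl | hn
  · obtain ⟨Λ, e, s', n, hn, H⟩ := h.determined_eqG s t
    refine ⟨Λ, e, s', n, hn, fun g γ g' γ' hs => ?_⟩
    simpa [Formula.Realize, h.cong_iff] using H g γ g' γ' hs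
  obtain ⟨f, hf⟩ := h.exists_eval_gterm s
  obtain ⟨f', hf'⟩ := h.exists_eval_gterm t
  refine ⟨∅, 0, f.support ∪ f'.support, n, hn, fun g γ g' γ' hs => ?_⟩
  obtain ⟨z, hz⟩ := exists_linearCombination_eq_add f fun j hj =>
    hs.cong j (Finset.mem_union_left _ hj)
  obtain ⟨z', hz'⟩ := exists_linearCombination_eq_add f' fun j hj =>
    hs.cong j (Finset.mem_union_right _ hj)
  rw [key, key]
  rintro ⟨y, hy⟩
  rw [hf, hf'] at hy
  refine ⟨y + z - z', ?_⟩
  rw [hf, hf', hz, hz', hy, smul_sub, smul_add]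
  abel

theorem determined_eqV (s t : VTerm C) : Determined M (.eqV s t) := by
  obtain ⟨k, α, hα⟩ := h.exists_eval_vterm s
  obtain ⟨l, β, hβ⟩ := h.exists_eval_vterm t
  refine determined_of_points α β k l fun g γ g' γ' hs => ?_
  simp only [Formula.Realize, hα, hβ, le_antisymm_iff]
  rw [hs α (by simp) β (by simp) k (le_max_left _ _) l (le_max_right _ _),
    hs β (by simp) α (by simp) l (le_max_right _ _) k (le_max_left _ _)]
  exact id

theorem determined_lt (s t : VTerm C) : Determined M (.lt s t) := by
  obtain ⟨k, α, hα⟩ := h.exists_eval_vterm s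
  obtain ⟨l, β, hβ⟩ := h.exists_eval_vterm t
  refine determined_of_points α β k l fun g γ g' γ' hs => ?_
  simp only [Formula.Realize, hα, hβ, h.lt_iff, ← not_le]
  rw [hs β (by simp) α (by simp) l (le_max_right _ _) k (le_max_left _ _)]
  exact id

/-- Induction on `φ`: implications use the symmetry of `Sim`, quantifiers the two extension lemmas.
-/
theorem determined (φ : Formula C) : Determined M φ := by
  classical
  induction φ with
  | falsum => exact ⟨∅, 0, ∅, 1, one_pos, fun _ _ _ _ _ hf => hf⟩
  | eqG s t => exact h.determined_eqG s t
  | eqV s t => exact h.determined_eqV s t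
  | cong n s t => exact h.determined_cong n s t
  | lt s t => exact h.determined_lt s t
  | imp φ ψ ihφ ihψ =>
    obtain ⟨Λ, e, s, n, hn, H⟩ := ihφ
    obtain ⟨Λ', e', s', n', hn', H'⟩ := ihψ
    refine ⟨Λ ∪ Λ', max e e', s ∪ s', n * n', Nat.mul_pos hn hn', fun g γ g' γ' hs hφψ hφ => ?_⟩
    refine H' g γ g' γ' (hs.mono Finset.subset_union_right (le_max_right _ _)
      Finset.subset_union_right (dvd_mul_left _ _)) (hφψ ?_)
    exact H g' γ' g γ (hs.symm.mono Finset.subset_union_left (le_max_left _ _)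
      Finset.subset_union_left (dvd_mul_right _ _)) hφ
  | allG i φ ih =>
    obtain ⟨Λ, e, s, n, hn, H⟩ := ih
    obtain ⟨Λ', e', s', n', hn', H'⟩ :=
      exists_sim_update_group h.isPValuedGroup Λ e s n hn (.inl i)
    refine ⟨Λ', e', s', n', hn', fun g γ g' γ' hs hφ x => ?_⟩
    obtain ⟨x', hx'⟩ := H' _ _ _ _ hs.symm x
    rw [← Str.tuple_update, ← Str.tuple_update] at hx'
    exact H _ _ _ _ hx'.symm (hφ x')
  | allV i φ ih =>
    obtain ⟨Λ, e, s, n, hn, H⟩ := ih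
    obtain ⟨Λ', e', H'⟩ := exists_sim_update_value h.isPValuedGroup Λ e s n i
    refine ⟨Λ', e', s, n, hn, fun g γ g' γ' hs hφ x => ?_⟩
    obtain ⟨x', hx'⟩ := H' _ _ _ _ hs.symm x
    exact H _ _ _ _ hx'.symm (hφ x')

end Str.IsPValued

/-! ### Counting traces -/

/-- The sets `{i | f i ≤ x}` form a chain as `x` varies, so cardinality determines them. Hence a cut
in `m` elements has only `m + 1` possibilities. -/
theorem le_iff_of_card_eq {ι Γ : Type*} [Fintype ι] [LinearOrder Γ] {f : ι → Γ} {x y : Γ}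
    (hxy : (Finset.univ.filter fun i => f i ≤ x).card = (Finset.univ.filter fun i => f i ≤ y).card)
    (i : ι) : f i ≤ x ↔ f i ≤ y := by
  wlog hle : x ≤ y generalizing x y
  · exact (this hxy.symm (le_of_not_ge hle)).symm
  have := Finset.eq_of_subset_of_card_le
    (Finset.monotone_filter_right Finset.univ fun i _ (hi : f i ≤ x) => hi.trans hle) hxy.ge
  simpa using Finset.ext_iff.1 this i

/-- A polynomial in `m` is eventually below `2 ^ m`. Taking `m = 2 ^ k - 1` turns the left side into
a power of two whose exponent is linear in `k`. -/
theorem exists_mul_pow_lt_two_pow (a b K : ℕ) :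
    ∃ m : ℕ, 0 < m ∧ m ^ a * ((m + 1) * ((m + 1) * 2)) ^ b * K < 2 ^ m := by
  set c := 2 * a + 4 * b + K + 2 with hc
  obtain ⟨k, hk⟩ : ∃ k, k * a + (2 * k + 1) * b + K < 2 ^ k - 1 := by
    refine ⟨2 * c, ?_⟩
    have h₁ : (c + 1) * (c + 1) ≤ 2 ^ (2 * c) := by
      rw [two_mul, pow_add]
      exact Nat.mul_le_mul Nat.lt_two_pow_self Nat.lt_two_pow_self
    refine lt_of_lt_of_le ?_ (Nat.sub_le_sub_right h₁ 1)
    have h₂ : (c + 1) * (c + 1) - 1 = c * c + 2 * c := by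
      rw [show (c + 1) * (c + 1) = c * c + 2 * c + 1 by ring, Nat.add_sub_cancel]
    rw [h₂]
    have h₃ : c * c = c * (2 * a + 4 * b + K + 2) := by rw [← hc]
    have h₄ : b + K < 2 * c := by omega
    nlinarith [Nat.zero_le (c * K)]
  have h2 : 2 ^ k - 1 + 1 = 2 ^ k := Nat.sub_add_cancel Nat.one_le_two_pow
  refine ⟨2 ^ k - 1, by omega, ?_⟩
  calc (2 ^ k - 1) ^ a * ((2 ^ k - 1 + 1) * ((2 ^ k - 1 + 1) * 2)) ^ b * K
      ≤ (2 ^ k) ^ a * (2 ^ k * (2 ^ k * 2)) ^ b * 2 ^ K := by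
        rw [h2]
        gcongr
        · exact Nat.sub_le _ _
        · exact Nat.lt_two_pow_self.le
    _ = 2 ^ (k * a + (2 * k + 1) * b + K) := by ring
    _ < 2 ^ (2 ^ k - 1) := Nat.pow_lt_pow_right one_lt_two hk

section Trace

variable {Γ L B : Type*} [LinearOrder Γ] {m e : ℕ}

/-- The data which determine the inequalities between shifts of the elements
`min (δ l b) (H l (κ l b) i)`, uniformly in `i`. -/
noncomputable def traceCode (S : Γ → Γ) (e : ℕ) (δ : L → B → Γ) (κ : L → B → Fin m)
    (H : L → Fin m → Fin m → Γ) (b : B) :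
    (L → Fin m) × (L × L × Fin (e + 1) × Fin (e + 1) → Fin (m + 1) × Fin (m + 1) × Bool) :=
  ⟨fun l => κ l b, fun x =>
    ⟨⟨(Finset.univ.filter fun i => S^[x.2.2.1] (H x.1 (κ x.1 b) i) ≤ S^[x.2.2.2] (δ x.2.1 b)).card,
      Nat.lt_succ_of_le ((Finset.card_le_univ _).trans_eq (Fintype.card_fin m))⟩,
    ⟨(Finset.univ.filter fun i =>
        OrderDual.toDual (S^[x.2.2.2] (H x.2.1 (κ x.2.1 b) i)) ≤
          OrderDual.toDual (S^[x.2.2.1] (δ x.1 b))).card,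
      Nat.lt_succ_of_le ((Finset.card_le_univ _).trans_eq (Fintype.card_fin m))⟩,
    decide (S^[x.2.2.1] (δ x.1 b) ≤ S^[x.2.2.2] (δ x.2.1 b))⟩⟩

/-- An inequality between minima splits into comparisons of `δ` with `δ`, of `δ` with `H` in either
direction, and of `H` with `H`. The code records the first kind outright and the mixed ones as cuts;
the last depends only on `κ`. -/
theorem sameOrder_of_traceCode_eq {S : Γ → Γ} {o t : Γ} (h : IsDiscreteOrder S o t)
    {δ : L → B → Γ} {κ : L → B → Fin m} {H : L → Fin m → Fin m → Γ} {b b' : B}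
    (hb : traceCode S e δ κ H b = traceCode S e δ κ H b') (i : Fin m) :
    SameOrder S Set.univ e (fun l => min (δ l b) (H l (κ l b) i))
      (fun l => min (δ l b') (H l (κ l b') i)) := by
  intro l _ k _ x hx y hy
  have hκ : ∀ l, κ l b = κ l b' := fun l => congrFun (congrArg Prod.fst hb) l
  have hcode := congrFun (congrArg Prod.snd hb)
    (l, k, ⟨x, Nat.lt_succ_of_le hx⟩, ⟨y, Nat.lt_succ_of_le hy⟩)
  simp only [traceCode, Prod.mk.injEq, Fin.mk.injEq, decide_eq_decide, hκ] at hcode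
  obtain ⟨h₁, h₂, h₃⟩ := hcode
  have h₁ := le_iff_of_card_eq h₁ i
  have h₂ := le_iff_of_card_eq h₂ i
  rw [OrderDual.toDual_le_toDual, OrderDual.toDual_le_toDual] at h₂
  simp only [h.iterate_min, min_le_iff, le_min_iff, hκ]
  rw [h₁, h₂, h₃]

end Trace

/-- Write `α i + β = (α k + β) + (α i - α k)`. If the two summands have distinct values, this is the
ultrametric rule; if they agree, maximality of `k` excludes a larger value of the sum. -/
theorem IsPValuedGroup.val_add_eq_min {p : ℕ} {G Γ ι : Type*} [AddCommGroup G] [LinearOrder Γ]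
    {S : Γ → Γ} {o t : Γ} {V : G → Γ} (h : IsPValuedGroup p S o t V) (α : ι → G) (β : G) (k : ι)
    (hk : ∀ i, V (α i + β) ≤ V (α k + β)) (i : ι) :
    V (α i + β) = min (V (α k + β)) (V (α i - α k)) := by
  have hsum : α i + β = (α k + β) + (α i - α k) := by abel
  by_cases hne : V (α k + β) = V (α i - α k)
  · have hle := h.le_val_add (α k + β) (α i - α k)
    rw [← hsum, ← hne, min_self] at hle
    rw [← hne, min_self]
    exact le_antisymm (hk i) hle
  · rw [hsum, h.val_add_of_ne (Or.inl hne)]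

theorem linearCombination_add {G J : Type*} [AddCommGroup G] (g g' : J → G) (f : J →₀ ℤ) :
    Finsupp.linearCombination ℤ (fun j => g j + g' j) f =
      Finsupp.linearCombination ℤ g f + Finsupp.linearCombination ℤ g' f := by
  simp [Finsupp.linearCombination_apply, Finsupp.sum, Finset.sum_add_distrib]

/-! ### The counting argument for NIP -/

namespace Str.IsPValued

variable {p : ℕ} {C : Type} {M : Str.{u} C} [AddCommGroup M.G] [LinearOrder M.Γ]
  (h : M.IsPValued p)

include h

/-- The elements named by points of tuples `(aᵢ, b)` are minima of an element which depends only on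
`b` and an element which depends only on `i` and some index. -/
theorem exists_pt_eq_min {B : Type*} {m : ℕ} [NeZero m] (X Y : Finset ℕ) (a : ℕ → ℕ → M.G)
    (a' : ℕ → ℕ → M.Γ) (b : B → ℕ → M.G) (b' : B → ℕ → M.Γ) (l : Point (ℕ ⊕ Option C)) :
    ∃ (δ : B → M.Γ) (κ : B → Fin m) (H : Fin m → Fin m → M.Γ), ∀ (i : Fin m) (I : B),
      pt M.val M.zeroΓ (M.tuple (X.piecewise (a i) (b I))) (Y.piecewise (a' i) (b' I)) l =
        min (δ I) (H (κ I) i) := by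
  have hG := h.isPValuedGroup
  rcases l with f | _ | k
  -- The combination splits into a part depending on `i` and a part depending on `I`; the constants
  -- go to the latter.
  · set u : ℕ → ℕ ⊕ Option C → M.G := fun i j => j.elim (X.piecewise (a i) 0) 0 with hu
    set v : B → ℕ ⊕ Option C → M.G := fun I => M.tuple (X.piecewise 0 (b I)) with hv
    have huv : ∀ i I, M.tuple (X.piecewise (a i) (b I)) = fun j => u i j + v I j := by
      intro i I
      funext j
      rcases j with j | _ | c
      · by_cases hj : j ∈ X <;> simp [hu, hv, Str.tuple, hj]
      · simp [hu, hv, Str.tuple]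
      · simp [hu, hv, Str.tuple]
    set α : Fin m → M.G := fun i => Finsupp.linearCombination ℤ (u i) f with hα
    set β : B → M.G := fun I => Finsupp.linearCombination ℤ (v I) f with hβ
    choose κ hκ using fun I => Finite.exists_max fun i => M.val (α i + β I)
    refine ⟨fun I => M.val (α (κ I) + β I), κ, fun k i => M.val (α i - α k), fun i I => ?_⟩
    rw [pt, huv, linearCombination_add]
    exact hG.val_add_eq_min α (β I) (κ I) (hκ I) i
  · exact ⟨fun _ => M.zeroΓ, fun _ => 0, fun _ _ => M.infty, fun i I => by
      simp [pt, hG.le_top]⟩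
  · by_cases hk : k ∈ Y
    · exact ⟨fun _ => M.infty, fun _ => 0, fun _ i => a' i k, fun i I => by
        simp [pt, hG.le_top, hk]⟩
    · exact ⟨fun I => b' I k, fun _ => 0, fun _ i => M.infty, fun i I => by
        simp [pt, hG.le_top, hk]⟩

/-- On `m` of the points, the trace of a parameter tuple is determined by its trace code and its
residues modulo `n`. Shattering would make this assignment injective on the `2 ^ m` subsets, which
exceeds the number of codes. -/
theorem not_shattersInfinite (φ : Formula C) (X Y : Finset ℕ) : ¬ φ.ShattersInfinite M X Y := by
  classical
  rintro ⟨a, a', b, b', hab⟩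
  have hG := h.isPValuedGroup
  obtain ⟨Λ, e, s, n, hn, hφ⟩ := h.determined φ
  obtain ⟨R, hR⟩ := hG.exists_reps n hn
  choose ρ hρR ζ hζ using hR
  obtain ⟨m, hm, hlt⟩ := exists_mul_pow_lt_two_pow (Nat.card Λ)
    (Nat.card (Λ × Λ × Fin (e + 1) × Fin (e + 1))) (Nat.card (s → R))
  have : NeZero m := ⟨hm.ne'⟩
  set set' : Finset (Fin m) → Set ℕ := fun I => Fin.val '' (I : Set (Fin m)) with hset
  choose δ κ H hH using fun l : Λ =>
    h.exists_pt_eq_min (m := m) X Y a a' (fun I => b (set' I)) (fun I => b' (set' I)) l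
  set code := fun I : Finset (Fin m) => (traceCode M.succ e δ κ H I,
    fun j : s => (⟨ρ (M.tuple (b (set' I)) j), hρR _⟩ : R)) with hcode
  have hinj : Function.Injective code := by
    suffices H : ∀ I I', code I = code I' → I ⊆ I' by
      exact fun I I' hII' => (H I I' hII').antisymm (H I' I hII'.symm)
    intro I I' hII' i hi
    have hmem : ∀ I : Finset (Fin m), (i : ℕ) ∈ set' I ↔ i ∈ I := by
      intro I
      simp [hset, Fin.val_inj]
    rw [← hmem, ← hab] at hi ⊢
    refine hφ _ _ _ _ ⟨?_, fun j hj => ?_⟩ hi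
    · intro l hl k hk x hx y hy
      have := sameOrder_of_traceCode_eq hG.toIsDiscreteOrder (congrArg Prod.fst hII') i
        ⟨l, hl⟩ trivial ⟨k, hk⟩ trivial x hx y hy
      simp only [← hH] at this
      exact this
    · have hρ : ρ (M.tuple (b (set' I)) j) = ρ (M.tuple (b (set' I')) j) :=
        congrArg Subtype.val (congrFun (congrArg Prod.snd hII') ⟨j, hj⟩)
      have hz := hζ (M.tuple (b (set' I)) j)
      have hz' := hζ (M.tuple (b (set' I')) j)
      rcases j with j | c
      · by_cases hjX : j ∈ X
        · exact ⟨0, by simp [Str.tuple, hjX]⟩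
        · refine ⟨ζ (M.tuple (b (set' I')) (.inl j)) - ζ (M.tuple (b (set' I)) (.inl j)), ?_⟩
          simp only [Str.tuple, Finset.piecewise_eq_of_notMem _ _ _ hjX] at hz hz' hρ ⊢
          rw [smul_sub, eq_sub_of_add_eq' hz.symm, eq_sub_of_add_eq' hz'.symm, hρ]
          abel
      · exact ⟨0, by rcases c with _ | c <;> simp [Str.tuple]⟩
  have hcard := Nat.card_le_card_of_injective code hinj
  simp only [Nat.card_eq_fintype_card (α := Finset (Fin m)), Fintype.card_finset, Nat.card_prod,
    Nat.card_fun, Nat.card_fin, Nat.card_eq_fintype_card (α := Bool), Fintype.card_bool,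
    Fintype.card_fin] at hcard hlt
  exact absurd hcard hlt.not_ge

end Str.IsPValued

/-! ### Models of the axioms are `p`-valued groups -/

/-! ### Semantics of the derived connectives and terms -/

section Realize

variable {C : Type} {M : Str.{u} C} {g : ℕ → M.G} {γ : ℕ → M.Γ} {φ ψ : Formula C}

theorem realize_not : φ.not.Realize M g γ ↔ ¬ φ.Realize M g γ := Iff.rfl

theorem realize_and : (φ.and ψ).Realize M g γ ↔ φ.Realize M g γ ∧ ψ.Realize M g γ := by
  simp only [Formula.and, Formula.not, Formula.Realize]
  tauto

theorem realize_or : (φ.or ψ).Realize M g γ ↔ φ.Realize M g γ ∨ ψ.Realize M g γ := by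
  simp only [Formula.or, Formula.not, Formula.Realize]
  tauto

theorem realize_iff : (φ.iff ψ).Realize M g γ ↔ (φ.Realize M g γ ↔ ψ.Realize M g γ) := by
  rw [Formula.iff, realize_and]
  exact iff_iff_implies_and_implies.symm

theorem realize_exG {i : ℕ} :
    (φ.exG i).Realize M g γ ↔ ∃ x, φ.Realize M (Function.update g i x) γ := by
  simp [Formula.exG, Formula.not, Formula.Realize]

theorem realize_exV {i : ℕ} :
    (φ.exV i).Realize M g γ ↔ ∃ x, φ.Realize M g (Function.update γ i x) := by
  simp [Formula.exV, Formula.not, Formula.Realize]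

theorem realize_le {s t : VTerm C} : (Formula.le s t).Realize M g γ ↔
    M.lt (s.eval M g γ) (t.eval M g γ) ∨ s.eval M g γ = t.eval M g γ := by
  rw [Formula.le, realize_or]
  rfl

theorem realize_disj {l : List (Formula C)} :
    (Formula.disj l).Realize M g γ ↔ ∃ φ ∈ l, φ.Realize M g γ := by
  induction l with
  | nil => simp [Formula.disj, Formula.Realize]
  | cons φ l ih => simp [Formula.disj, realize_or, ih]

theorem realize_exGs {k : ℕ} : (Formula.exGs k φ).Realize M g γ ↔
    ∃ x : ℕ → M.G, φ.Realize M (fun i => if i < k then x i else g i) γ := by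
  induction k generalizing φ with
  | zero => simpa [Formula.exGs] using fun _ => ⟨M.zero⟩
  | succ k ih =>
    rw [Formula.exGs, ih]
    simp only [realize_exG]
    constructor
    · rintro ⟨x, y, hxy⟩
      refine ⟨Function.update x k y, ?_⟩
      convert hxy using 2 with i
      rcases lt_trichotomy i k with hi | rfl | hi
      · rw [if_pos (by omega), Function.update_of_ne hi.ne, Function.update_of_ne hi.ne, if_pos hi]
      · simp
      · rw [if_neg (by omega), Function.update_of_ne hi.ne', if_neg (by omega)]
    · rintro ⟨x, hx⟩
      refine ⟨x, x k, ?_⟩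
      convert hx using 2 with i
      rcases lt_trichotomy i k with hi | rfl | hi
      · rw [if_pos (by omega), Function.update_of_ne hi.ne, if_pos hi]
      · simp
      · rw [if_neg (by omega), Function.update_of_ne hi.ne', if_neg (by omega)]

theorem eval_succs (k : ℕ) (s : VTerm C) :
    (VTerm.succs k s).eval M g γ = M.succ^[k] (s.eval M g γ) := by
  induction k with
  | zero => rfl
  | succ k ih => rw [VTerm.succs, VTerm.eval, ih, Function.iterate_succ_apply']

theorem eval_nsmul [AddCommGroup M.G] (h₀ : M.zero = 0) (hadd : ∀ x y, M.add x y = x + y) (n : ℕ)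
    (s : GTerm C) : (GTerm.nsmul n s).eval M g = n • s.eval M g := by
  induction n with
  | zero => simpa [GTerm.nsmul, GTerm.eval] using h₀
  | succ n ih => rw [GTerm.nsmul, GTerm.eval, ih, hadd, succ_nsmul]

theorem eval_zsmul [AddCommGroup M.G] (h₀ : M.zero = 0) (hadd : ∀ x y, M.add x y = x + y)
    (hneg : ∀ x, M.neg x = -x) (n : ℤ) (s : GTerm C) :
    (GTerm.zsmul n s).eval M g = n • s.eval M g := by
  cases n with
  | ofNat n => simp [GTerm.zsmul, eval_nsmul h₀ hadd]
  | negSucc n => rw [GTerm.zsmul, GTerm.eval, eval_nsmul h₀ hadd, hneg, negSucc_zsmul]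

end Realize

open Formula in
/-- Sentences which hold in all models of `T_{pV,N}` and do not contain the constants `c_{n,j}`. The
index of `qG` is at most `k q`. -/
inductive CoreAxioms (p : ℕ) (k : Nat.Primes → ℕ) {C : Type} : Formula C → Prop
  | add_assoc : CoreAxioms p k <| allG 0 <| allG 1 <| allG 2 <|
      .add (.add (gv 0) (gv 1)) (gv 2) =ᴳ .add (gv 0) (.add (gv 1) (gv 2))
  | add_comm : CoreAxioms p k <| allG 0 <| allG 1 <| .add (gv 0) (gv 1) =ᴳ .add (gv 1) (gv 0)
  | add_zero : CoreAxioms p k <| allG 0 <| .add (gv 0) .zero =ᴳ gv 0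
  | add_neg : CoreAxioms p k <| allG 0 <| .add (gv 0) (.neg (gv 0)) =ᴳ .zero
  | cong_iff (n : ℕ) : CoreAxioms p k <| allG 0 <| allG 1 <|
      cong n (gv 0) (gv 1) ↔ᶠ exG 2 (gv 0 =ᴳ .add (gv 1) (.nsmul n (gv 2)))
  | index (q : Nat.Primes) : CoreAxioms p k <| exGs (k q) <| allG (k q) <|
      disj ((List.range (k q)).map fun i => cong q (gv (k q)) (gv i))
  | lt_irrefl : CoreAxioms p k <| allV 0 <| ¬ᶠ(vv 0 <ⱽ vv 0)
  | lt_trans : CoreAxioms p k <| allV 0 <| allV 1 <| allV 2 <|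
      vv 0 <ⱽ vv 1 →ᶠ vv 1 <ⱽ vv 2 →ᶠ vv 0 <ⱽ vv 2
  | lt_total : CoreAxioms p k <| allV 0 <| allV 1 <|
      vv 0 <ⱽ vv 1 ∨ᶠ vv 0 =ⱽ vv 1 ∨ᶠ vv 1 <ⱽ vv 0
  | zero_le : CoreAxioms p k <| allV 0 <| .zero ≤ⱽ vv 0
  | zero_lt_infty : CoreAxioms p k <| .zero <ⱽ .infty
  | le_infty : CoreAxioms p k <| allV 0 <| vv 0 ≤ⱽ .infty
  | succ : CoreAxioms p k <| allV 0 <| vv 0 <ⱽ .infty →ᶠ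
      vv 0 <ⱽ .succ (vv 0) ∧ᶠ .succ (vv 0) <ⱽ .infty ∧ᶠ
        allV 1 (vv 0 <ⱽ vv 1 →ᶠ .succ (vv 0) ≤ⱽ vv 1)
  | succ_infty : CoreAxioms p k <| .succ .infty =ⱽ .infty
  | pred : CoreAxioms p k <| allV 0 <|
      .zero <ⱽ vv 0 →ᶠ vv 0 <ⱽ .infty →ᶠ exV 1 (.succ (vv 1) =ⱽ vv 0)
  | val_surjective : CoreAxioms p k <| allV 0 <| exG 0 <| .val (gv 0) =ⱽ vv 0
  | val_eq_infty : CoreAxioms p k <| allG 0 <| .val (gv 0) =ⱽ .infty ↔ᶠ gv 0 =ᴳ .zero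
  | val_zsmul (n : ℤ) (h : n ≠ 0) : CoreAxioms p k <| allG 0 <|
      .val (.zsmul n (gv 0)) =ⱽ .succs (padicValInt p n) (.val (gv 0))
  | val_add : CoreAxioms p k <| allG 0 <| allG 1 <|
      .val (gv 0) ≤ⱽ .val (.add (gv 0) (gv 1)) ∨ᶠ .val (gv 1) ≤ⱽ .val (.add (gv 0) (gv 1))
  | digits : CoreAxioms p k <| allG 0 <| allG 1 <|
      .val (gv 0) =ⱽ .val (gv 1) →ᶠ .val (gv 0) <ⱽ .infty →ᶠ disj ((List.range p).map digit)
  | dense (n : ℕ+) : CoreAxioms p k <| allG 0 <|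
      .succs (padicValNat p n) .zero ≤ⱽ .val (gv 0) →ᶠ
        allV 0 (.succs (padicValNat p n) .zero ≤ⱽ vv 0 →ᶠ vv 0 <ⱽ .infty →ᶠ
          exG 1 (exG 2 (gv 1 =ᴳ .nsmul n (gv 2)) ∧ᶠ vv 0 ≤ⱽ .val (.sub (gv 0) (gv 1))))

/-- The algebraic and order instances are built from the symbols of `M` themselves, so each axiom
unfolds to a field of `Str.IsPValued`. -/
theorem CoreAxioms.not_shattersInfinite {p : ℕ} {k : Nat.Primes → ℕ} {C : Type} {M : Str.{u} C}
    (hM : ∀ φ : Formula C, CoreAxioms p k φ → M.Satisfies φ) (φ : Formula C) (X Y : Finset ℕ) :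
    ¬ φ.ShattersInfinite M X Y := by
  have hM' := fun φ hφ => hM φ hφ (fun _ => M.zero) (fun _ => M.zeroΓ)
  have add_assoc := hM' _ .add_assoc
  have add_comm := hM' _ .add_comm
  have add_zero := hM' _ .add_zero
  have add_neg := hM' _ .add_neg
  have lt_irrefl := hM' _ .lt_irrefl
  have lt_trans := hM' _ .lt_trans
  have lt_total := hM' _ .lt_total
  simp [Formula.Realize, GTerm.eval, VTerm.eval, realize_not, realize_or]
    at add_assoc add_comm add_zero add_neg lt_irrefl lt_trans lt_total
  let : Add M.G := ⟨M.add⟩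
  let : Zero M.G := ⟨M.zero⟩
  let : Neg M.G := ⟨M.neg⟩
  let : AddCommGroup M.G :=
    { add_assoc := add_assoc
      zero_add := fun x => (add_comm _ _).trans (add_zero x)
      add_zero := add_zero
      nsmul := nsmulRec
      zsmul := zsmulRec
      neg_add_cancel := fun x => (add_comm _ _).trans (add_neg x)
      add_comm := add_comm }
  classical
  have : IsStrictTotalOrder M.Γ M.lt :=
    { irrefl := lt_irrefl
      trans := lt_trans
      trichotomous := fun x y h₁ h₂ => ((lt_total x y).resolve_left h₁).resolve_right h₂ }
  let : LinearOrder M.Γ := linearOrderOfSTO M.lt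
  have h₀ : M.zero = 0 := rfl
  have hadd : ∀ x y, M.add x y = x + y := fun _ _ => rfl
  have hneg : ∀ x, M.neg x = -x := fun _ => rfl
  have hlt : ∀ x y, M.lt x y ↔ x < y := fun _ _ => Iff.rfl
  have cong_iff := fun n => hM' _ (.cong_iff n)
  have index := fun q => hM' _ (.index q)
  have zero_le := hM' _ .zero_le
  have zero_lt_infty := hM' _ .zero_lt_infty
  have le_infty := hM' _ .le_infty
  have succ := hM' _ .succ
  have succ_infty := hM' _ .succ_infty
  have pred := hM' _ .pred
  have val_surjective := hM' _ .val_surjective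
  have val_eq_infty := hM' _ .val_eq_infty
  have val_zsmul := fun n hn => hM' _ (.val_zsmul n hn)
  have val_add := hM' _ .val_add
  have digits := hM' _ .digits
  have dense := fun n => hM' _ (.dense n)
  simp [Formula.Realize, GTerm.eval, VTerm.eval, realize_and, realize_or, realize_iff, realize_exG,
    realize_exV, realize_le, realize_disj, realize_exGs, eval_succs, digit, GTerm.sub,
    eval_nsmul h₀ hadd, eval_zsmul h₀ hadd hneg, h₀, hadd, hneg, hlt, ← le_iff_lt_or_eq,
    ← sub_eq_add_neg]
    at cong_iff index zero_le zero_lt_infty le_infty succ succ_infty pred val_surjective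
      val_eq_infty val_zsmul val_add digits dense
  have hPV : M.IsPValued p :=
    { zero_eq := h₀
      add_eq := hadd
      neg_eq := hneg
      lt_iff := hlt
      cong_iff := cong_iff
      isPValuedGroup :=
      { bot_le := zero_le
        le_top := le_infty
        bot_lt_top := zero_lt_infty
        succ_top := succ_infty
        lt_succ := fun γ hγ => (succ γ hγ).1
        succ_lt_top := fun γ hγ => (succ γ hγ).2.1
        succ_le := fun γ δ hγδ => (succ γ (hγδ.trans_le (le_infty δ))).2.2 δ hγδ
        pred := pred
        val_surjective := val_surjective
        val_eq_top_iff := val_eq_infty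
        val_zsmul := fun n x hn => val_zsmul n hn x
        le_val_add := fun x y => min_le_iff.2 (val_add x y)
        digit := digits
        dense := fun n hn x hx γ hγ hγ' => dense ⟨n, hn⟩ x hx γ hγ' hγ
        finite_index := fun q hq => by
          obtain ⟨x, hx⟩ := index ⟨q, hq⟩
          refine ⟨(Finset.range (k ⟨q, hq⟩)).image x, fun y => ?_⟩
          obtain ⟨i, hi, hy⟩ := hx y
          rw [Function.update_of_ne hi.ne, if_pos hi, cong_iff] at hy
          exact ⟨x i, Finset.mem_image_of_mem _ (Finset.mem_range.2 hi), hy⟩ } }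
  exact hPV.not_shattersInfinite φ X Y

open Formula in
theorem satisfies_of_isModel_TpV {p : ℕ} {N : Nat.Primes → ℕ} {M : Str.{u} (CosetConst N)}
    (hM : M.IsModel (TpV p N)) (φ : Formula (CosetConst N))
    (hφ : CoreAxioms p (fun q => q ^ N q) φ) : M.Satisfies φ := by
  cases hφ with
  | add_assoc => exact hM _ .add_assoc
  | add_comm => exact hM _ .add_comm
  | add_zero => exact hM _ .add_zero
  | add_neg => exact hM _ .add_neg
  | cong_iff n => exact hM _ (.cong_iff n)
  | index q =>
    intro g γ
    have := hM _ (.index q) g γ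
    rw [indexEq, realize_exGs] at this
    obtain ⟨x, hx⟩ := this
    exact realize_exGs.2 ⟨x, (realize_and.1 hx).2⟩
  | lt_irrefl => exact hM _ .lt_irrefl
  | lt_trans => exact hM _ .lt_trans
  | lt_total => exact hM _ .lt_total
  | zero_le => exact hM _ .zero_le
  | zero_lt_infty => exact hM _ .zero_lt_infty
  | le_infty => exact hM _ .le_infty
  | succ => exact hM _ .succ
  | succ_infty => exact hM _ .succ_infty
  | pred => exact hM _ .pred
  | val_surjective => exact hM _ .val_surjective
  | val_eq_infty => exact hM _ .val_eq_infty
  | val_zsmul n hn => exact hM _ (.val_zsmul n hn)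
  | val_add => exact hM _ .val_add
  | digits =>
    intro g γ x y hxy hx
    obtain ⟨ψ, hψ, hreal⟩ := realize_disj.1 (hM _ .digits g γ x y hxy hx)
    obtain ⟨i, hi, rfl⟩ := List.mem_map.1 hψ
    rw [List.mem_range'_1] at hi
    refine realize_disj.2 ⟨_, List.mem_map.2 ⟨i, List.mem_range.2 ?_, rfl⟩, (realize_and.1 hreal).1⟩
    omega
  | dense n => exact hM _ (.dense n)

/-! ### The integers -/

theorem intStr_succ_iterate (p k : ℕ) (x : ℕ∞) : (intStr p).succ^[k] x = (x + k : ℕ∞) := by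
  change (fun y : ℕ∞ => y + 1)^[k] x = x + k
  induction k with
  | zero => simp
  | succ k ih => rw [Function.iterate_succ_apply', ih, Nat.cast_succ, add_assoc]

section

variable (p : ℕ) [hp : Fact p.Prime]

theorem emultiplicity_int_mul (n : ℤ) (hn : n ≠ 0) (x : ℤ) :
    emultiplicity (p : ℤ) (n * x) = emultiplicity (p : ℤ) x + padicValInt p n := by
  rw [emultiplicity_mul (Nat.prime_iff_prime_int.1 hp.out), add_comm,
    padicValInt.of_ne_one_ne_zero hp.out.ne_one hn]
  congr 1
  exact (Int.finiteMultiplicity_iff.2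
    ⟨by simpa using hp.out.ne_one, hn⟩).emultiplicity_eq_multiplicity

/-- After removing the common power of `p`, the digit is the quotient of the two unit parts in `ZMod
p`. -/
theorem exists_digit_int {x y : ℤ} (hxy : emultiplicity (p : ℤ) x = emultiplicity (p : ℤ) y)
    (hx : emultiplicity (p : ℤ) x < ⊤) :
    ∃ i < p, emultiplicity (p : ℤ) x < emultiplicity (p : ℤ) (x - i * y) := by
  have hfx : FiniteMultiplicity (p : ℤ) x := finiteMultiplicity_iff_emultiplicity_ne_top.2 hx.ne
  have hfy : FiniteMultiplicity (p : ℤ) y :=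
    finiteMultiplicity_iff_emultiplicity_ne_top.2 (hxy ▸ hx.ne)
  have hmul : multiplicity (p : ℤ) x = multiplicity (p : ℤ) y :=
    multiplicity_eq_of_emultiplicity_eq hxy
  obtain ⟨x', hx', -⟩ := hfx.exists_eq_pow_mul_and_not_dvd
  obtain ⟨y', hy', hpy⟩ := hfy.exists_eq_pow_mul_and_not_dvd
  rw [← hmul] at hy'
  have hy0 : (y' : ZMod p) ≠ 0 := by rwa [Ne, ZMod.intCast_zmod_eq_zero_iff_dvd]
  refine ⟨((x' : ZMod p) / y').val, ZMod.val_lt _, ?_⟩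
  set i := ((x' : ZMod p) / y').val with hi
  have hdvd : (p : ℤ) ∣ x' - i * y' := by
    rw [← ZMod.intCast_zmod_eq_zero_iff_dvd]
    push_cast
    rw [hi, ZMod.natCast_zmod_val, div_mul_cancel₀ _ hy0, sub_self]
  obtain ⟨c, hc⟩ := hdvd
  have : (p : ℤ) ^ (multiplicity (p : ℤ) x + 1) ∣ x - i * y := by
    refine ⟨c, ?_⟩
    rw [pow_succ, mul_assoc, ← hc, mul_sub, ← hx', mul_left_comm, ← hy']
  rw [hfx.emultiplicity_eq_multiplicity]
  refine lt_of_lt_of_le ?_ (le_emultiplicity_of_pow_dvd this)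
  exact_mod_cast Nat.lt_succ_self _

/-- Write `n = p^v n'` with `n'` prime to `p`, and `x = p^v x'`. As `n'` is invertible modulo `p^γ`,
with inverse `a`, the choice `z = a x'` works. -/
theorem exists_dense_int {n : ℕ} (hn : 0 < n) {x : ℤ}
    (hx : (padicValNat p n : ℕ∞) ≤ emultiplicity (p : ℤ) x) (γ : ℕ) :
    ∃ z, (γ : ℕ∞) ≤ emultiplicity (p : ℤ) (x - n * z) := by
  obtain ⟨n', hpn, hn'⟩ := (Nat.finiteMultiplicity_iff.2
    ⟨hp.out.ne_one, hn⟩).exists_eq_pow_mul_and_not_dvd.imp fun _ h => h.symm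
  rw [← padicValNat_def' hp.out.ne_one hn.ne'] at hn'
  obtain ⟨x', rfl⟩ := pow_dvd_of_le_emultiplicity hx
  have hco : IsCoprime (n' : ℤ) ((p : ℤ) ^ γ) := by
    refine IsCoprime.pow_right ?_
    rw [Nat.isCoprime_iff_coprime]
    exact ((Nat.Prime.coprime_iff_not_dvd hp.out).2 hpn).symm
  obtain ⟨a, b, hab⟩ := hco
  refine ⟨a * x', le_emultiplicity_of_pow_dvd ⟨p ^ padicValNat p n * x' * b, ?_⟩⟩
  have : (n : ℤ) = p ^ padicValNat p n * n' := by exact_mod_cast hn'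
  rw [this]
  linear_combination (-(p : ℤ) ^ padicValNat p n * x') * hab

theorem intStr_satisfies (φ : Formula Empty) (hφ : CoreAxioms p (fun q => q) φ) :
    (intStr p).Satisfies φ := by
  intro g γ
  have hle : ∀ {s t : VTerm Empty} {g : ℕ → (intStr p).G} {γ : ℕ → (intStr p).Γ},
      (Formula.le s t).Realize (intStr p) g γ ↔
        @LE.le ℕ∞ _ (s.eval (intStr p) g γ) (t.eval (intStr p) g γ) := fun {s t g γ} =>
    realize_le.trans (le_iff_lt_or_eq (α := ℕ∞)).symm
  let : AddCommGroup (intStr p).G := inferInstanceAs (AddCommGroup ℤ)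
  have hns : ∀ (n : ℕ) (s : GTerm Empty) (g : ℕ → (intStr p).G),
      (GTerm.nsmul n s).eval (intStr p) g = Int.mul n (s.eval (intStr p) g) := fun n s g =>
    (eval_nsmul rfl (fun _ _ => rfl) n s).trans (nsmul_eq_mul (α := ℤ) n _)
  have hzs : ∀ (n : ℤ) (s : GTerm Empty) (g : ℕ → (intStr p).G),
      (GTerm.zsmul n s).eval (intStr p) g = Int.mul n (s.eval (intStr p) g) := fun n s g =>
    (eval_zsmul rfl (fun _ _ => rfl) (fun _ => rfl) n s).trans (zsmul_eq_mul (α := ℤ) _ n)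
  cases hφ with
  | add_assoc => exact fun x y z => Int.add_assoc x y z
  | add_comm => exact fun x y => Int.add_comm x y
  | add_zero => exact fun x => Int.add_zero x
  | add_neg => exact fun x => Int.add_right_neg x
  | cong_iff n =>
    intro (x : ℤ) (y : ℤ)
    rw [realize_iff, realize_exG]
    refine Iff.trans (b := ∃ z : ℤ, x = y + n * z) ?_ (exists_congr fun z => ?_)
    · exact Int.modEq_comm.trans Int.modEq_iff_add_fac
    · simp only [Formula.Realize, GTerm.eval, hns]
      rfl
  | index q =>
    rw [realize_exGs]
    -- The representatives modulo `q` are `0, …, q - 1`; the one for `y` is its remainder.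
    refine ⟨fun i => (i : ℤ), fun (y : ℤ) => realize_disj.2 ?_⟩
    have hq : (0 : ℤ) < q := by exact_mod_cast q.2.pos
    have hmod := Int.emod_lt_of_pos y hq
    obtain ⟨i, hi⟩ := Int.eq_ofNat_of_zero_le (Int.emod_nonneg y hq.ne')
    have hiq : i < (q : ℕ) := by omega
    refine ⟨_, List.mem_map.2 ⟨i, List.mem_range.2 hiq, rfl⟩, ?_⟩
    have hcong : ∀ u v : (intStr p).G, u = y → v = (i : ℤ) → (intStr p).cong q u v := by
      intro u v hu hv
      have hyi : y ≡ i [ZMOD q] := by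
        rw [← Int.ofNat_eq_natCast, ← hi]
        exact (Int.mod_modEq y q).symm
      rw [hu, hv]
      exact hyi
    exact hcong _ _ (Function.update_self _ _ _)
      ((Function.update_of_ne hiq.ne _ _).trans (if_pos hiq))
  | lt_irrefl => exact fun x => lt_irrefl (α := ℕ∞) x
  | lt_trans => exact fun x y z => lt_trans (α := ℕ∞)
  | lt_total =>
    intro x y
    rw [realize_or, realize_or]
    exact lt_trichotomy (α := ℕ∞) x y
  | zero_le => exact fun x => hle.2 (bot_le (α := ℕ∞))
  | zero_lt_infty => exact ENat.top_pos
  | le_infty => exact fun x => hle.2 (le_top (α := ℕ∞))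
  | succ =>
    intro x hx
    rw [realize_and, realize_and]
    refine ⟨?_, ?_, fun y hxy => hle.2 ?_⟩
    · exact ENat.lt_add_one_iff (ne_of_lt hx) |>.2 le_rfl
    · exact ENat.add_lt_top.2 ⟨hx, ENat.one_lt_top⟩
    · exact Order.add_one_le_of_lt (α := ℕ∞) hxy
  | succ_infty => exact top_add (α := ℕ∞) 1
  | pred =>
    intro (x : ℕ∞) h0 hx
    refine realize_exV.2 ⟨(x - 1 : ℕ∞), ?_⟩
    exact tsub_add_cancel_of_le (α := ℕ∞) (Order.one_le_iff_pos.2 h0)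
  | val_surjective =>
    intro (x : ℕ∞)
    rw [realize_exG]
    induction x with
    | top => exact ⟨(0 : ℤ), emultiplicity_zero _⟩
    | coe k => exact ⟨((p : ℤ) ^ k : ℤ), emultiplicity_pow_self (by exact_mod_cast hp.out.ne_zero)
        (Nat.prime_iff_prime_int.1 hp.out).not_isUnit k⟩
  | val_eq_infty =>
    intro (x : ℤ)
    rw [realize_iff]
    change emultiplicity (p : ℤ) x = ⊤ ↔ x = (0 : ℤ)
    rw [emultiplicity_eq_top, Int.finiteMultiplicity_iff]
    simp [hp.out.ne_one]
  | val_zsmul n hn =>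
    intro x
    simp only [Formula.Realize, VTerm.eval, hzs, eval_succs]
    exact (emultiplicity_int_mul p n hn x).trans (intStr_succ_iterate p _ _).symm
  | val_add =>
    intro x y
    rw [realize_or, hle, hle]
    exact min_le_iff.1 (min_le_emultiplicity_add (p := (p : ℤ)) (a := x) (b := y))
  | digits =>
    intro x y hxy hx
    obtain ⟨i, hi, hlt⟩ := exists_digit_int p hxy hx
    refine realize_disj.2 ⟨_, List.mem_map.2 ⟨i, List.mem_range.2 hi, rfl⟩, ?_⟩
    simp only [digit, Formula.Realize, VTerm.eval, GTerm.sub, GTerm.eval, hns]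
    exact hlt
  | dense n =>
    intro (x : ℤ) hx (y : ℕ∞) hy hyt
    have hx' : (padicValNat p n : ℕ∞) ≤ emultiplicity (p : ℤ) x := by
      have := hle.1 hx
      simp only [eval_succs] at this
      exact ((zero_add _).symm.trans (intStr_succ_iterate p _ 0).symm).trans_le this
    obtain ⟨k, hk⟩ := ENat.ne_top_iff_exists.1 (ne_of_lt hyt)
    obtain ⟨z, hz⟩ := exists_dense_int p n.pos hx' k
    rw [realize_exG]
    refine ⟨(n * z : ℤ), realize_and.2 ⟨realize_exG.2 ⟨z, ?_⟩, hle.2 ?_⟩⟩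
    · simp only [Formula.Realize, hns]
      rfl
    · have hk' : (k : ℕ∞) = y := hk
      rw [hk'] at hz
      exact hz

end

end PV

theorem mainTheorem4 (p : ℕ) [hp : Fact p.Prime] :
    (∀ N : Nat.Primes → ℕ, N ⟨p, hp.out⟩ ≠ 0 → PV.IsNIP.{u} (PV.TpV p N)) ∧
      PV.IsNIP.{u} (PV.intStr p).theory :=
  ⟨fun _ _ _ hM => PV.CoreAxioms.not_shattersInfinite (PV.satisfies_of_isModel_TpV hM),
    fun _ hM => PV.CoreAxioms.not_shattersInfinite fun φ hφ => hM φ (PV.intStr_satisfies p φ hφ)⟩
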